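/- Let $K$ be an algebraically closed field, $K_0\subset K$ a perfect subfield, and let $n,d$ be integers with $2\le d<n$, $\gcd(n,d)=1$ and $\mathrm{char}(K)\nmid d$. For a polynomial $f(x)\in K_0[x]$ of degree $n$ without repeated roots let $\mathcal C_{f,d}$ be the smooth projective model over $K_0$ of the affine curve $y^d=f(x)$ and $\mathcal O_{f,d}\in\mathcal C_{f,d}(K_0)$ its only point at infinity. The order of a point $\mathcal P$ of $\mathcal C_{f,d}$ is the order, in the group of $K$-points of the Jacobian of $\mathcal C_{f,d}$, of the class of the divisor $(\mathcal P)-(\mathcal O_{f,d})$. Put $\ell_0=\lfloor (n+d)/d\rfloor$ and $m_0=d\ell_0$, and suppose that $n-m_0+\ell_0\ge 0$. Let $f(x)\in K_0[x]$ be a polynomial of degree $n$ without repeated roots, and let $\mathcal P\in\mathcal C_{f,d}(K_0)$. Then $\mathcal P$ has order $m_0$ if and only if there exists a polynomial $\tilde f(x)\in K_0[x]$ of degree $n$ without repeated roots with the following properties. (i) There exist a nonzero $\tilde B\in K_0$ and a polynomial $w(x)\in K_0[x]$ of degree $\ell_0$ with leading coefficient $\tilde B$ such that $w(0)=1$ and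 $\tilde f(x)=-\tilde B^d x^{m_0}+w(x)^d$. (ii) For these $\tilde B$ and $w$ there is a nonzero polynomial $\tilde q(x)\in K_0[x]$ of degree $n-m_0+\ell_0$ such that $\tilde q(0)=1$ and $w(x)=\tilde B x^{\ell_0}+\tilde q(x)$. (iii) There is an isomorphism of algebraic $K_0$-curves $\mathcal C_{f,d}\to\mathcal C_{\tilde f,d}$ that sends $\mathcal O_{f,d}$ to $\mathcal O_{\tilde f,d}$ and $\mathcal P$ to $\mathcal Q=(0,1)\in\mathcal C_{\tilde f,d}(K_0)$. Moreover, for every polynomial $\tilde f(x)\in K_0[x]$ of degree $n$ without repeated roots that satisfies (i) and (ii), $\mathcal Q=(0,1)$ is a $K_0$-point of order $m_0$ on $\mathcal C_{\tilde f,d}$. -/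

import Mathlib

open Polynomial

noncomputable section

namespace Superelliptic

/-! ### Nonsingular projective curves as sets of discrete valuation rings

The (closed points of the) nonsingular projective curve with function field `F` over `k` are the
discrete valuation rings of `F` that contain `k`. -/

/-- A closed point of the nonsingular projective model of the function field `F / k`. -/
@[ext]
structure Place (k F : Type*) [Field k] [Field F] [Algebra k F] where
  /-- the local ring of the point -/
  ring : ValuationSubring F
  algebraMap_mem : ∀ c : k, algebraMap k F c ∈ ring
  isDVR : IsDiscreteValuationRing ring

section Place

variable {k F k' F' : Type*} [Field k] [Field F] [Algebra k F] [Field k'] [Field F'] [Algebra k' F']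

instance Place.instIsDVR (P : Place k F) : IsDiscreteValuationRing P.ring := P.isDVR

/-- `h` is regular at the point and vanishes there: `h` lies in the maximal ideal. -/
def Place.Vanishes (P : Place k F) (h : F) : Prop := h ∈ P.ring.nonunits

/-- `h` is regular at the point `P` and takes the value `c ∈ k` there. -/
def Place.HasValue (P : Place k F) (h : F) (c : k) : Prop := P.Vanishes (h - algebraMap k F c)

/-- The residue field of the point is `k`: every function that is regular at `P` has a value
in `k`. -/
def Place.IsRational (P : Place k F) : Prop := ∀ h ∈ P.ring, ∃ c : k, P.HasValue h c

/-- The normalized order of vanishing at `P` of a nonzero function `h`. -/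
def Place.ord (P : Place k F) (h : F) : ℤ :=
  -WithZero.log ((IsDiscreteValuationRing.maximalIdeal P.ring).valuation F h)

theorem Place.ord_one (P : Place k F) : P.ord 1 = 0 := by
  simp [Place.ord]

theorem Place.ord_mul (P : Place k F) {g h : F} (hg : g ≠ 0) (hh : h ≠ 0) :
    P.ord (g * h) = P.ord g + P.ord h := by
  rw [Place.ord, map_mul, WithZero.log_mul, neg_add]
  · rfl
  · simpa using hg
  · simpa using hh

theorem Place.ord_inv (P : Place k F) (g : F) : P.ord g⁻¹ = -P.ord g := by
  simp [Place.ord, map_inv₀, WithZero.log_inv]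

/-- For a homomorphism `φ : F → F'` of function fields, i.e. the pullback of functions along a
morphism from the curve of `F'` to the curve of `F`: that morphism sends the point `P'` to the
point `P`. -/
def Place.MapsTo (φ : F →+* F') (P' : Place k' F') (P : Place k F) : Prop :=
  P.ring = P'.ring.comap φ

end Place

/-! ### Divisor classes of degree zero over an algebraically closed field -/

section Divisors

variable (k F : Type*) [Field k] [IsAlgClosed k] [Field F] [Algebra k F]

/-- Divisors of degree zero (over an algebraically closed field all points have degree one). -/
abbrev Div0 : AddSubgroup (Place k F →₀ ℤ) := (Finsupp.degree : (Place k F →₀ ℤ) →+ ℤ).ker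

/-- The subgroup of principal divisors. -/
def principal : AddSubgroup (Div0 k F) where
  carrier := {D | ∃ h : F, h ≠ 0 ∧ ∀ P, (D : Place k F →₀ ℤ) P = P.ord h}
  zero_mem' := ⟨1, one_ne_zero, fun P => by simp [P.ord_one]⟩
  add_mem' := by
    rintro D E ⟨g, hg, hD⟩ ⟨h, hh, hE⟩
    exact ⟨g * h, mul_ne_zero hg hh, fun P => by simp [P.ord_mul hg hh, hD P, hE P]⟩
  neg_mem' := by
    rintro D ⟨g, hg, hD⟩
    exact ⟨g⁻¹, inv_ne_zero hg, fun P => by simp [P.ord_inv, hD P]⟩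

/-- The group `Pic⁰` of divisor classes of degree zero, i.e. the group of `k`-points of the
jacobian of the curve. -/
abbrev Jacobian : Type _ := Div0 k F ⧸ principal k F

variable {k F}

/-- The canonical map from the curve to its jacobian with base point `O`: the class of
`(P) - (O)`. -/
def toJacobian (O P : Place k F) : Jacobian k F :=
  QuotientAddGroup.mk ⟨Finsupp.single P 1 - Finsupp.single O 1, by
    simp [AddMonoidHom.mem_ker]⟩

end Divisors

/-! ### The curves `y ^ d = f(x)` -/

/-- The data of a curve `y ^ d = f(x)` over `k`: integers `2 ≤ d < n` with `(n, d) = 1` and `d`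
nonzero in `k`, and a polynomial `f` of degree `n` without repeated roots. -/
structure Curve (k : Type*) [Field k] (n d : ℕ) where
  two_le : 2 ≤ d
  lt : d < n
  coprime : Nat.Coprime n d
  cast_ne_zero : (d : k) ≠ 0
  /-- the polynomial `f` -/
  poly : k[X]
  natDegree_poly : poly.natDegree = n
  separable : poly.Separable

namespace Curve

variable {k : Type*} [Field k] {n d : ℕ}

/-- The polynomial `Y ^ d - f(x)` over the field `k(x)`. -/
def equation (E : Curve k n d) : (RatFunc k)[X] := X ^ d - C (algebraMap k[X] (RatFunc k) E.poly)

instance irreducible_equation (E : Curve k n d) : Fact (Irreducible E.equation) := by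
  have hd : d ≠ 0 := by have := E.two_le; omega
  have hmonic : (X ^ d - C E.poly : k[X][X]).Monic := monic_X_pow_sub_C _ hd
  have hmap : E.equation = (X ^ d - C E.poly : k[X][X]).map (algebraMap k[X] (RatFunc k)) := by
    simp [equation]
  refine ⟨?_⟩
  rw [hmap, ← hmonic.irreducible_iff_irreducible_map_fraction_map]
  have hnd : E.poly.natDegree ≠ 0 := by
    have := E.natDegree_poly; have := E.lt; omega
  have hu : ¬ IsUnit E.poly := fun h => hnd (natDegree_eq_zero_of_isUnit h)
  have h0 : E.poly ≠ 0 := by rintro h; simp [h] at hnd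
  obtain ⟨p, hp, hpf⟩ := WfDvdMonoid.exists_irreducible_factor hu h0
  have hdeg : (X ^ d - C E.poly : k[X][X]).natDegree = d := natDegree_X_pow_sub_C
  refine irreducible_of_eisenstein_criterion (P := Ideal.span {p})
    ((Ideal.span_singleton_prime hp.ne_zero).2 hp.prime) ?_ ?_ ?_ ?_ hmonic.isPrimitive
  · rw [hmonic.leadingCoeff, Ideal.mem_span_singleton]
    exact fun h => hp.not_isUnit (isUnit_of_dvd_one h)
  · intro m hm
    rw [degree_eq_natDegree hmonic.ne_zero, hdeg, Nat.cast_lt] at hm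
    rw [Ideal.mem_span_singleton, coeff_sub, coeff_X_pow, if_neg hm.ne, zero_sub, dvd_neg, coeff_C]
    split_ifs
    · exact hpf
    · exact dvd_zero p
  · rw [← natDegree_pos_iff_degree_pos, hdeg]; omega
  · rw [Ideal.span_singleton_pow, Ideal.mem_span_singleton, coeff_sub, coeff_X_pow,
      if_neg hd.symm, zero_sub, dvd_neg, coeff_C_zero, pow_two]
    exact fun h => hp.not_isUnit (E.separable.squarefree p h)

/-- The field `k(x)[y] / (y ^ d - f(x))` of rational functions on the curve. -/
abbrev FunctionField (E : Curve k n d) : Type _ := AdjoinRoot E.equation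

/-- The coordinate function `x`. -/
def x (E : Curve k n d) : E.FunctionField := AdjoinRoot.of E.equation RatFunc.X

/-- The coordinate function `y`. -/
def y (E : Curve k n d) : E.FunctionField := AdjoinRoot.root E.equation

/-- Closed points of the smooth projective model of `y ^ d = f(x)`. -/
abbrev Point (E : Curve k n d) : Type _ := Place k E.FunctionField

/-- The point at infinity: the only point where `x` is not regular. -/
def IsInfinity (E : Curve k n d) (O : E.Point) : Prop := E.x ∉ O.ring

/-- `P` is the affine point `(a, b)`. -/
def IsAffinePoint (E : Curve k n d) (P : E.Point) (a b : k) : Prop :=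
  P.HasValue E.x a ∧ P.HasValue E.y b

section BaseChange

variable (E : Curve k n d) (K : Type*) [Field K] [Algebra k K]

/-- The same equation over an extension field. -/
def baseChange : Curve K n d where
  two_le := E.two_le
  lt := E.lt
  coprime := E.coprime
  cast_ne_zero := by
    rw [← map_natCast (algebraMap k K)]
    exact (_root_.map_ne_zero _).2 E.cast_ne_zero
  poly := E.poly.map (algebraMap k K)
  natDegree_poly := by rw [natDegree_map, E.natDegree_poly]
  separable := E.separable.map

/-- The inclusion `k(x) → K(x)`. -/
def ratFuncMap (k K : Type*) [Field k] [Field K] [Algebra k K] : RatFunc k →+* RatFunc K :=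
  RatFunc.mapRingHom (mapRingHom (algebraMap k K))
    (nonZeroDivisors_le_comap_nonZeroDivisors_of_injective _
      (map_injective _ (algebraMap k K).injective))

theorem ratFuncMap_algebraMap (p : k[X]) :
    ratFuncMap k K (algebraMap k[X] (RatFunc k) p) =
      algebraMap K[X] (RatFunc K) (p.map (algebraMap k K)) := by
  have h := RatFunc.map_apply_div (mapRingHom (algebraMap k K))
    (nonZeroDivisors_le_comap_nonZeroDivisors_of_injective _
      (map_injective _ (algebraMap k K).injective)) p 1
  simpa [ratFuncMap, RatFunc.coe_mapRingHom_eq_coe_map] using h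

/-- The inclusion of function fields `k(𝒞) → K(𝒞)` that sends `x` to `x` and `y` to `y`. -/
def functionFieldMap : E.FunctionField →+* (E.baseChange K).FunctionField :=
  AdjoinRoot.map (ratFuncMap k K) E.equation (E.baseChange K).equation
    (dvd_of_eq (by simp [equation, baseChange, ratFuncMap_algebraMap]))

end BaseChange

/-- The `k`-rational points. -/
def RationalPoint (E : Curve k n d) : Type _ := {P : E.Point // P.IsRational}

/-- The `k`-point `P`, viewed as a point of the curve over the algebraically closed field `K`, has
order `m` in the group of `K`-points of the jacobian, the point `O` at infinity being the zero. -/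
def HasOrder (E : Curve k n d) (K : Type*) [Field K] [IsAlgClosed K] [Algebra k K]
    (P : E.RationalPoint) (m : ℕ) : Prop :=
  ∃ O PK : (E.baseChange K).Point, (E.baseChange K).IsInfinity O ∧
    PK.MapsTo (E.functionFieldMap K) P.1 ∧ 0 < m ∧ addOrderOf (toJacobian O PK) = m

/-- An isomorphism `𝒞 ≅ 𝒞'` of smooth projective `k`-curves, given by the pullback of rational
functions `k(𝒞') ≅ k(𝒞)`. -/
structure Iso (E E' : Curve k n d) where
  pullback : E'.FunctionField ≃ₐ[k] E.FunctionField

/-- The isomorphism sends the point `P` of `𝒞` to the point `P'` of `𝒞'`. -/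
def Iso.Sends {E E' : Curve k n d} (ψ : Iso E E') (P : E.Point) (P' : E'.Point) : Prop :=
  P.MapsTo (ψ.pullback : E'.FunctionField →+* E.FunctionField) P'

/-- The isomorphism sends the point at infinity to the point at infinity. -/
def Iso.PreservesInfinity {E E' : Curve k n d} (ψ : Iso E E') : Prop :=
  ∃ (O : E.Point) (O' : E'.Point), E.IsInfinity O ∧ E'.IsInfinity O' ∧ ψ.Sends O O'

end Curve

/-- `ℓ₀ = [(n + d) / d]`. -/
def ell0 (n d : ℕ) : ℕ := (n + d) / d

/-- `m₀ = d ℓ₀`. -/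
def m0 (n d : ℕ) : ℕ := d * ell0 n d

/-- `f = -B ^ d x ^ m₀ + w ^ d` with `B ≠ 0`, where `w` has degree `ℓ₀`, leading coefficient `B` and
`w(0) = 1`, and `w = B x ^ ℓ₀ + q` with a nonzero polynomial `q` of degree `n - m₀ + ℓ₀` such that
`q(0) = 1`. -/
def IsNormalForm {k : Type*} [Field k] (n d : ℕ) (f : k[X]) : Prop :=
  ∃ (B : k) (w q : k[X]), B ≠ 0 ∧
    w.natDegree = ell0 n d ∧ w.leadingCoeff = B ∧ w.eval 0 = 1 ∧
    f = -C (B ^ d) * X ^ m0 n d + w ^ d ∧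
    q ≠ 0 ∧ (q.natDegree : ℤ) = (n : ℤ) - m0 n d + ell0 n d ∧ q.eval 0 = 1 ∧
    w = C B * X ^ ell0 n d + q

end Superelliptic

end

/-! An order statement about `P` becomes an equation for `f`. Over `K`, the order of `P` divides
`m₀` exactly when some function `g` has divisor `m₀(P) - m₀(O)`. Such a `g` has no affine poles.
Since `k[x, y]` is integrally closed (`exists_aeval_y_eq_of_isIntegral`), `g` is a polynomial in `x`
and `y` of degree less than `d` in `y`. At infinity `x` and `y` have poles of order `d` and `n`, and
monomials with different powers of `y` have pole orders that differ mod `d`, so nothing cancels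
(`valuation_aeval_y`).

Because `n < m₀ < n + d < 2n`, the function is `u(x) + c y` with `c` constant. If `c = 0`, then `u`
is a constant times a power of `x - a` and the order of `P` already divides `d`. Otherwise `g` is
proportional to `y - w(x)`, and `w^d - f` has `a` as its only root, so `f = w^d - B^d (x - a)^m₀`
with `B` the leading coefficient of `w` (`IsTangentForm`, `exists_isTangentForm`). Conversely this
equation makes `div(y - w) = m₀(P) - m₀(O)`. A smaller positive multiple `r(P) - r(O)` with `r < n`
would be the divisor of a polynomial in `x`, which is impossible for `b ≠ 0`; as `m₀ < 2n`, the
order is exactly `m₀` (`IsTangentForm.addOrderOf_eq`).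

The polynomial `w` is a `d`-th root of `f` modulo `(x - a)^m₀` with `w(a) = b`, hence its
coefficients lie in the base field (`coeff_mem_range_of_X_pow_dvd`). Finally, an isomorphism that
fixes infinity is `x ↦ αx + β`, `y ↦ γy` (`Iso.exists_eq`). These substitutions preserve tangent
form and can move `P` to `(0, 1)`, where tangent form is the normal form (`isNormalForm_iff`). -/

noncomputable section

namespace Superelliptic

/-! ### The ring `k[x, y]` is integrally closed. -/

namespace Curve

variable {k : Type*} [Field k] {n d : ℕ} (E : Curve k n d)

theorem d_ne_zero (E : Curve k n d) : d ≠ 0 := by have := E.two_le; omega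

/-- The polynomial `Y ^ d - f(x)` over the ring `k[x]`. -/
def affineEquation : k[X][X] := X ^ d - C E.poly

theorem affineEquation_monic : E.affineEquation.Monic := monic_X_pow_sub_C _ E.d_ne_zero

theorem natDegree_affineEquation : E.affineEquation.natDegree = d := natDegree_X_pow_sub_C

theorem map_affineEquation :
    E.affineEquation.map (algebraMap k[X] (RatFunc k)) = E.equation := by
  simp [affineEquation, equation]

theorem equation_monic : E.equation.Monic := monic_X_pow_sub_C _ E.d_ne_zero

theorem algebraMap_X : algebraMap k[X] E.FunctionField X = E.x := by
  rw [IsScalarTower.algebraMap_apply k[X] (RatFunc k) E.FunctionField]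
  simp [x]

theorem algebraMap_C (c : k) :
    algebraMap k[X] E.FunctionField (C c) = algebraMap k E.FunctionField c := by
  rw [IsScalarTower.algebraMap_apply k k[X] E.FunctionField]; rfl

theorem algebraMap_injective : Function.Injective (algebraMap k[X] E.FunctionField) := by
  rw [IsScalarTower.algebraMap_eq k[X] (RatFunc k) E.FunctionField]
  exact (algebraMap (RatFunc k) E.FunctionField).injective.comp (RatFunc.algebraMap_injective k)

instance : FaithfulSMul k[X] E.FunctionField :=
  (faithfulSMul_iff_algebraMap_injective _ _).2 E.algebraMap_injective

theorem aeval_x (u : k[X]) : aeval E.x u = algebraMap k[X] E.FunctionField u := by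
  rw [← E.algebraMap_X, aeval_algebraMap_apply E.FunctionField (X : k[X]) u, aeval_X_left_apply]

theorem aeval_y_eq_zero_iff (p : k[X][X]) : aeval E.y p = 0 ↔ E.affineEquation ∣ p := by
  have h : aeval E.y p = AdjoinRoot.mk E.equation (p.map (algebraMap k[X] (RatFunc k))) := by
    rw [← AdjoinRoot.aeval_eq, aeval_map_algebraMap]; rfl
  rw [h, AdjoinRoot.mk_eq_zero, ← E.map_affineEquation,
    Polynomial.map_dvd_map (algebraMap k[X] (RatFunc k)) (RatFunc.algebraMap_injective k)
    E.affineEquation_monic]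

theorem y_pow : E.y ^ d = algebraMap k[X] E.FunctionField E.poly := by
  have h : aeval E.y E.affineEquation = 0 := (E.aeval_y_eq_zero_iff _).2 dvd_rfl
  rw [affineEquation] at h
  simpa [sub_eq_zero] using h

theorem poly_ne_zero : E.poly ≠ 0 := E.separable.ne_zero

theorem x_ne_zero : E.x ≠ 0 := by
  rw [← E.algebraMap_X, Ne, map_eq_zero_iff _ E.algebraMap_injective]
  exact X_ne_zero

theorem y_ne_zero : E.y ≠ 0 := by
  intro h
  have := E.y_pow
  rw [h, zero_pow E.d_ne_zero, eq_comm, map_eq_zero_iff _ E.algebraMap_injective] at this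
  exact E.poly_ne_zero this

/-- Every polynomial in `x` and `y` is a polynomial of degree less than `d` in `y`. -/
theorem exists_natDegree_lt_aeval_y_eq (p : k[X][X]) :
    ∃ q : k[X][X], q.natDegree < d ∧ aeval E.y q = aeval E.y p := by
  refine ⟨p %ₘ E.affineEquation, ?_, ?_⟩
  · have := natDegree_modByMonic_lt p E.affineEquation_monic (by
      intro h
      have := E.natDegree_affineEquation
      rw [h, natDegree_one] at this
      exact E.d_ne_zero this.symm)
    rwa [E.natDegree_affineEquation] at this
  · have h := modByMonic_add_div p E.affineEquation
    conv_rhs => rw [← h]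
    rw [map_add, (E.aeval_y_eq_zero_iff (_ * _)).2 (dvd_mul_right _ _), add_zero]

theorem isIntegral_y : IsIntegral k[X] E.y :=
  ⟨E.affineEquation, E.affineEquation_monic, by
    rw [← aeval_def, aeval_y_eq_zero_iff]⟩

theorem minpoly_y : minpoly k[X] E.y = E.affineEquation :=
  (IsIntegrallyClosed.minpoly.unique E.affineEquation_monic
    ((E.aeval_y_eq_zero_iff _).2 dvd_rfl) fun q hq h =>
      degree_le_of_dvd ((E.aeval_y_eq_zero_iff q).1 h) hq.ne_zero).symm

theorem equation_separable : E.equation.Separable := by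
  refine separable_X_pow_sub_C _ ?_ ?_
  · rw [← map_natCast (algebraMap k (RatFunc k))]
    exact (_root_.map_ne_zero _).2 E.cast_ne_zero
  · exact (map_ne_zero_iff _ (RatFunc.algebraMap_injective k)).2 E.poly_ne_zero

/-- The basis `1, y, …, y ^ (d - 1)` of the function field over `k(x)`. -/
def powerBasis : PowerBasis (RatFunc k) E.FunctionField :=
  AdjoinRoot.powerBasis E.equation_monic.ne_zero

theorem powerBasis_gen : E.powerBasis.gen = E.y := rfl

theorem minpoly_ratFunc_y : minpoly (RatFunc k) E.y = E.equation := by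
  have := AdjoinRoot.minpoly_powerBasis_gen_of_monic E.equation_monic
  exact this

instance : FiniteDimensional (RatFunc k) E.FunctionField := E.powerBasis.finite

instance : Algebra.IsSeparable (RatFunc k) E.FunctionField := by
  have h : IsSeparable (RatFunc k) E.y := by
    rw [IsSeparable, minpoly_ratFunc_y]; exact E.equation_separable
  have h1 := (IntermediateField.isSeparable_adjoin_simple_iff_isSeparable _ _).2 h
  have h2 : IntermediateField.adjoin (RatFunc k) {E.y} = ⊤ :=
    IntermediateField.adjoin_eq_top_of_algebra _ _ E.powerBasis.adjoin_gen_eq_top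
  rw [h2] at h1
  exact Algebra.IsSeparable.of_algHom (RatFunc k) _
    (IntermediateField.topEquiv (F := RatFunc k) (E := E.FunctionField)).symm.toAlgHom

/-- Up to sign the discriminant is the norm of `d y^(d-1)`, and the norm of `y` is `f` up to sign.
Hence only prime factors of `f` can obstruct integral closedness. -/
theorem discr_powerBasis : ∃ c : k, c ≠ 0 ∧ Algebra.discr (RatFunc k) E.powerBasis.basis =
    algebraMap k[X] (RatFunc k) (C c * E.poly ^ (d - 1)) := by
  have hn : Algebra.norm (RatFunc k) E.y =
      (-1) ^ d * -algebraMap k[X] (RatFunc k) E.poly := by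
    have h := Algebra.PowerBasis.norm_gen_eq_coeff_zero_minpoly E.powerBasis
    rw [powerBasis_gen, minpoly_ratFunc_y, ← PowerBasis.finrank, E.powerBasis.finrank,
      ← PowerBasis.natDegree_minpoly, powerBasis_gen, minpoly_ratFunc_y] at h
    rw [h, equation, natDegree_X_pow_sub_C, coeff_sub, coeff_X_pow, if_neg E.d_ne_zero.symm,
      coeff_C_zero, zero_sub]
  have hd : Algebra.norm (RatFunc k) (d : E.FunctionField) = (d : RatFunc k) ^ E.powerBasis.dim := by
    rw [← map_natCast (algebraMap (RatFunc k) E.FunctionField), Algebra.norm_algebraMap,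
      E.powerBasis.finrank]
  have hder : aeval E.y (derivative E.equation) = d * E.y ^ (d - 1) := by
    have h : derivative E.equation = C (d : RatFunc k) * X ^ (d - 1) := by
      rw [equation, derivative_sub, derivative_X_pow, derivative_C, sub_zero]
    rw [h]
    simp
  rw [Algebra.discr_powerBasis_eq_norm, powerBasis_gen, minpoly_ratFunc_y, hder, map_mul, map_pow,
    hn, hd, E.powerBasis.finrank]
  generalize E.powerBasis.dim = N
  refine ⟨(-1) ^ (N * (N - 1) / 2) * (d ^ N * ((-1) ^ d * -1) ^ (d - 1)), ?_, ?_⟩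
  · have := E.cast_ne_zero
    simp [this]
  · simp only [map_mul, map_pow, map_neg, map_one, map_natCast]
    ring

/-- As `f` is squarefree, `Y^d - f` is Eisenstein at each prime factor of `f`, so these primes can
be cancelled one after another. -/
theorem mem_adjoin_of_dvd_poly {N : ℕ} (g : k[X]) (hg : g ∣ E.poly) :
    ∀ z : E.FunctionField, IsIntegral k[X] z →
      g ^ N • z ∈ Algebra.adjoin k[X] {E.y} → z ∈ Algebra.adjoin k[X] {E.y} := by
  induction g using UniqueFactorizationMonoid.induction_on_prime with
  | h₁ => exact absurd (zero_dvd_iff.1 hg) E.poly_ne_zero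
  | h₂ u hu =>
    intro z hz h
    obtain ⟨v, hv⟩ := (hu.pow N).exists_left_inv
    have := Subalgebra.smul_mem _ h v
    rwa [smul_smul, hv, one_smul] at this
  | h₃ g p hg0 hp ih =>
    intro z hz h
    refine ih (dvd_of_mul_left_dvd hg) z hz ?_
    rw [mul_pow, ← smul_smul] at h
    refine mem_adjoin_of_smul_prime_pow_smul_of_minpoly_isEisensteinAt (B := E.powerBasis) (K := RatFunc k) hp
      E.isIntegral_y (hz.smul _) h ?_
    rw [powerBasis_gen, minpoly_y]
    refine ⟨?_, ?_, ?_⟩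
    · rw [E.affineEquation_monic.leadingCoeff, Ideal.submodule_span_eq, Ideal.mem_span_singleton]
      exact fun h => hp.not_isUnit (isUnit_of_dvd_one h)
    · intro m hm
      rw [natDegree_affineEquation] at hm
      rw [Ideal.submodule_span_eq, Ideal.mem_span_singleton, affineEquation, coeff_sub, coeff_X_pow,
        if_neg hm.ne, zero_sub, dvd_neg, coeff_C]
      split_ifs
      · exact dvd_of_mul_right_dvd hg
      · exact dvd_zero p
    · rw [Ideal.submodule_span_eq, Ideal.span_singleton_pow, Ideal.mem_span_singleton,
        affineEquation, coeff_sub, coeff_X_pow, if_neg E.d_ne_zero.symm, zero_sub, dvd_neg,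
        coeff_C_zero, pow_two]
      exact fun h => hp.not_isUnit (E.separable.squarefree p h)

/-- The ring `k[x, y]` is integrally closed. -/
theorem exists_aeval_y_eq_of_isIntegral {z : E.FunctionField} (hz : IsIntegral k[X] z) :
    ∃ p : k[X][X], p.natDegree < d ∧ aeval E.y p = z := by
  have hz' : z ∈ Algebra.adjoin k[X] {E.y} := by
    refine E.mem_adjoin_of_dvd_poly (N := d - 1) E.poly dvd_rfl z hz ?_
    have h := Algebra.discr_mul_isIntegral_mem_adjoin (RatFunc k) (B := E.powerBasis)
      E.isIntegral_y hz
    obtain ⟨c, hc, h'⟩ := E.discr_powerBasis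
    rw [h', algebraMap_smul, ← smul_smul] at h
    have := Subalgebra.smul_mem _ h (C c⁻¹)
    rwa [smul_smul, ← C_mul, inv_mul_cancel₀ hc, C_1, one_smul] at this
  rw [Algebra.adjoin_singleton_eq_range_aeval] at hz'
  obtain ⟨q, rfl⟩ := hz'
  exact E.exists_natDegree_lt_aeval_y_eq q

end Curve

/-! ### Normalized valuations at places. -/

namespace Place

variable {k F : Type*} [Field k] [Field F] [Algebra k F] (P : Place k F)

open scoped WithZero

/-- The normalized valuation at a point. -/
def valuation : Valuation F ℤᵐ⁰ := (IsDiscreteValuationRing.maximalIdeal P.ring).valuation F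

theorem valuation_le_one_iff {g : F} : P.valuation g ≤ 1 ↔ g ∈ P.ring := by
  constructor
  · intro h
    obtain ⟨a, rfl⟩ := IsDiscreteValuationRing.exists_lift_of_le_one h
    exact a.2
  · intro h
    exact IsDedekindDomain.HeightOneSpectrum.valuation_le_one _ (⟨g, h⟩ : P.ring)

theorem valuation_lt_one_iff {g : F} : P.valuation g < 1 ↔ P.Vanishes g := by
  rw [Vanishes, ValuationSubring.mem_nonunits_iff_or, ← P.valuation_le_one_iff]
  by_cases hg : g = 0
  · simp [hg]
  · rw [map_inv₀, not_le, one_lt_inv₀ (zero_lt_iff.2 ((_root_.map_ne_zero _).2 hg))]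
    simp [hg]

theorem ord_eq (g : F) : P.ord g = -(P.valuation g).log := rfl

theorem valuation_eq_exp {g : F} (hg : g ≠ 0) : P.valuation g = WithZero.exp (-P.ord g) := by
  rw [ord_eq, neg_neg, WithZero.exp_log ((_root_.map_ne_zero _).2 hg)]

theorem ord_nonneg_iff {g : F} (hg : g ≠ 0) : 0 ≤ P.ord g ↔ g ∈ P.ring := by
  rw [← valuation_le_one_iff, P.valuation_eq_exp hg, ← WithZero.exp_zero, WithZero.exp_le_exp]
  simp

theorem ord_pos_iff {g : F} (hg : g ≠ 0) : 0 < P.ord g ↔ P.Vanishes g := by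
  rw [← valuation_lt_one_iff, P.valuation_eq_exp hg, ← WithZero.exp_zero, WithZero.exp_lt_exp]
  simp

theorem ord_eq_zero {g : F} (hg : g ∈ P.ring) (hv : ¬ P.Vanishes g) : P.ord g = 0 := by
  have h0 : g ≠ 0 := by
    rintro rfl; exact hv (by rw [← valuation_lt_one_iff]; simp)
  have h1 := (P.ord_nonneg_iff h0).2 hg
  have h2 := mt (P.ord_pos_iff h0).1 hv
  omega

theorem ord_pow (g : F) (m : ℕ) : P.ord (g ^ m) = m * P.ord g := by
  rw [ord_eq, ord_eq, map_pow, WithZero.log_pow]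
  simp

theorem ord_neg (g : F) : P.ord (-g) = P.ord g := by
  rw [ord_eq, ord_eq, Valuation.map_neg]

theorem valuation_algebraMap {c : k} (hc : c ≠ 0) : P.valuation (algebraMap k F c) = 1 := by
  refine le_antisymm (P.valuation_le_one_iff.2 (P.algebraMap_mem c)) ?_
  have h := P.valuation_le_one_iff.2 (P.algebraMap_mem c⁻¹)
  rw [map_inv₀, map_inv₀] at h
  exact (inv_le_one₀ (zero_lt_iff.2 ((_root_.map_ne_zero _).2 (by simpa using hc)))).1 h

theorem ord_algebraMap {c : k} (hc : c ≠ 0) : P.ord (algebraMap k F c) = 0 := by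
  rw [ord_eq, P.valuation_algebraMap hc]; simp

theorem exists_ord_eq_one : ∃ g : F, g ≠ 0 ∧ P.ord g = 1 := by
  obtain ⟨g, hg⟩ :=
    (IsDiscreteValuationRing.maximalIdeal P.ring).valuation_exists_uniformizer F
  refine ⟨g, ?_, ?_⟩
  · rintro rfl; rw [map_zero] at hg; exact WithZero.exp_ne_zero hg.symm
  · rw [ord, hg]; simp

theorem ring_ne_top : P.ring ≠ ⊤ := by
  obtain ⟨g, hg0, hg⟩ := P.exists_ord_eq_one
  intro h
  have h1 : g⁻¹ ∈ P.ring := by rw [h]; trivial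
  rw [← P.ord_nonneg_iff (inv_ne_zero hg0), P.ord_inv] at h1
  omega

end Place

/-! ### Affine points and maximal ideals of `k[x, y]`. -/

theorem isDiscreteValuationRing_adic {A F : Type*} [CommRing A] [IsDedekindDomain A] [Field F]
    [Algebra A F] [IsFractionRing A F] (v : IsDedekindDomain.HeightOneSpectrum A) :
    IsDiscreteValuationRing (v.valuation F).valuationSubring := by
  infer_instance

/-- The Taylor expansion to first order. -/
theorem exists_eq_add_mul_add_mul {k : Type*} [Field k] (p : k[X][X]) (a b : k) :
    ∃ q : k[X], ∃ r : k[X][X], p = C (C (p.evalEval a b)) + C ((X - C a) * q) + (X - C (C b)) * r := by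
  obtain ⟨r, hr⟩ := X_sub_C_dvd_sub_C_eval (a := C b) (p := p)
  obtain ⟨q, hq⟩ := X_sub_C_dvd_sub_C_eval (a := a) (p := p.eval (C b))
  refine ⟨q, r, ?_⟩
  rw [← hr, ← hq, evalEval, C_sub]
  ring

namespace Curve

variable {k : Type*} [Field k] {n d : ℕ} (E : Curve k n d)

theorem aeval_y_mem {V : ValuationSubring E.FunctionField}
    (hk : ∀ c : k, algebraMap k E.FunctionField c ∈ V) (hx : E.x ∈ V) (p : k[X][X]) :
    aeval E.y p ∈ V := by
  have h1 (u : k[X]) : algebraMap k[X] E.FunctionField u ∈ V := by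
    rw [← aeval_x, aeval_eq_sum_range]
    exact sum_mem fun i _ => by
      rw [Algebra.smul_def]; exact mul_mem (hk _) (pow_mem hx _)
  -- A valuation ring is integrally closed, and `y^d = f(x)` lies in it.
  have hy : E.y ∈ V := by
    have := h1 E.poly
    rw [← y_pow, ← V.valuation_le_one_iff, map_pow, pow_le_one_iff E.d_ne_zero,
      V.valuation_le_one_iff] at this
    exact this
  rw [aeval_eq_sum_range]
  exact sum_mem fun i _ => by
    rw [Algebra.smul_def]; exact mul_mem (h1 _) (pow_mem hy _)

theorem aeval_y_sub_mem_nonunits {V : ValuationSubring E.FunctionField}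
    (hk : ∀ c : k, algebraMap k E.FunctionField c ∈ V) {a b : k}
    (hx : E.x - algebraMap k E.FunctionField a ∈ V.nonunits)
    (hy : E.y - algebraMap k E.FunctionField b ∈ V.nonunits) (p : k[X][X]) :
    aeval E.y p - algebraMap k E.FunctionField (p.evalEval a b) ∈ V.nonunits := by
  have hx' : E.x ∈ V := by
    have := V.add_mem _ _ (V.nonunits_subset hx) (hk a)
    simpa using this
  have hmul {s t : E.FunctionField} (hs : s ∈ V.nonunits) (ht : t ∈ V) : s * t ∈ V.nonunits := by
    rw [ValuationSubring.mem_nonunits_iff] at hs ⊢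
    rw [map_mul]
    exact mul_lt_one_of_lt_of_le hs ((V.valuation_le_one_iff _).2 ht)
  obtain ⟨q, r, h⟩ := exists_eq_add_mul_add_mul p a b
  have h2 := congrArg (aeval E.y) h
  simp only [map_add, map_mul, aeval_C, map_sub, aeval_X, algebraMap_X, algebraMap_C] at h2
  rw [h2, add_assoc, add_sub_cancel_left]
  refine add_mem (hmul hx ?_) (hmul hy (E.aeval_y_mem hk hx' r))
  have := E.aeval_y_mem hk hx' (C q)
  rwa [aeval_C] at this

instance : IsDedekindDomain (integralClosure k[X] E.FunctionField) :=
  integralClosure.isDedekindDomain k[X] (RatFunc k) E.FunctionField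

instance : IsFractionRing (integralClosure k[X] E.FunctionField) E.FunctionField :=
  IsIntegralClosure.isFractionRing_of_finite_extension k[X] (RatFunc k) E.FunctionField _

theorem mem_of_isIntegral {V : ValuationSubring E.FunctionField}
    (hk : ∀ c : k, algebraMap k E.FunctionField c ∈ V) (hx : E.x ∈ V) {z : E.FunctionField}
    (hz : IsIntegral k[X] z) : z ∈ V := by
  obtain ⟨p, -, rfl⟩ := E.exists_aeval_y_eq_of_isIntegral hz
  exact E.aeval_y_mem hk hx p

/-- A valuation ring of the function field on which `x` is regular is the local ring at a maximal
ideal of the affine coordinate ring. -/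
theorem exists_heightOneSpectrum {V : ValuationSubring E.FunctionField}
    (hk : ∀ c : k, algebraMap k E.FunctionField c ∈ V) (hx : E.x ∈ V) (hV : V ≠ ⊤) :
    ∃ v : IsDedekindDomain.HeightOneSpectrum (integralClosure k[X] E.FunctionField),
      (v.valuation E.FunctionField).valuationSubring = V ∧
      ∀ s : integralClosure k[X] E.FunctionField, s ∈ v.asIdeal ↔ (s : E.FunctionField) ∈ V.nonunits := by
  let φ : integralClosure k[X] E.FunctionField →+* V :=
    { toFun := fun s => ⟨s, E.mem_of_isIntegral hk hx s.2⟩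
      map_one' := rfl
      map_mul' := fun _ _ => rfl
      map_zero' := rfl
      map_add' := fun _ _ => rfl }
  have hmem (s) : s ∈ (IsLocalRing.maximalIdeal V).comap φ ↔ (s : E.FunctionField) ∈ V.nonunits := by
    rw [Ideal.mem_comap, ← ValuationSubring.coe_mem_nonunits_iff]; rfl
  -- If the contraction were zero, all nonzero integral elements would be units of `V`, and `V`
  -- would be the whole field.
  have hbot : (IsLocalRing.maximalIdeal V).comap φ ≠ ⊥ := by
    intro h
    refine hV (top_unique fun g _ => ?_)
    obtain ⟨s, t, ht, rfl⟩ := IsFractionRing.div_surjective (integralClosure k[X] E.FunctionField) g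
    have ht0 : t ≠ 0 := nonZeroDivisors.ne_zero ht
    have h1 := mt (hmem t).2 (by rw [h]; simpa using ht0)
    rw [ValuationSubring.mem_nonunits_iff_or] at h1
    push Not at h1
    rw [div_eq_mul_inv]
    exact V.mul_mem _ _ (φ s).2 h1.2
  let v : IsDedekindDomain.HeightOneSpectrum (integralClosure k[X] E.FunctionField) :=
    ⟨(IsLocalRing.maximalIdeal V).comap φ, inferInstance, hbot⟩
  refine ⟨v, ?_, hmem⟩
  -- The localization is contained in `V`, and a discrete valuation ring is maximal among proper
  -- subrings of its fraction field.
  rw [← IsDedekindDomain.HeightOneSpectrum.valuationSubringAtPrime_eq_valuationSubring]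
  refine ValuationSubring.eq_of_le_of_ne_top _ ?_ hV
  rintro g ⟨s, t, ht, rfl⟩
  have h1 := mt (hmem t).2 ht
  rw [ValuationSubring.mem_nonunits_iff_or] at h1
  push Not at h1
  exact V.mul_mem _ _ (φ s).2 h1.2

/-- The point whose local ring is a given valuation ring. -/
def pointOfValuationSubring (V : ValuationSubring E.FunctionField)
    (hk : ∀ c : k, algebraMap k E.FunctionField c ∈ V) (hx : E.x ∈ V) (hV : V ≠ ⊤) : E.Point where
  ring := V
  algebraMap_mem := hk
  isDVR := by
    obtain ⟨v, hv, -⟩ := E.exists_heightOneSpectrum hk hx hV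
    exact hv ▸ isDiscreteValuationRing_adic v

theorem aeval_y_mem_nonunits_iff {V : ValuationSubring E.FunctionField}
    (hk : ∀ c : k, algebraMap k E.FunctionField c ∈ V) {a b : k}
    (hx : E.x - algebraMap k E.FunctionField a ∈ V.nonunits)
    (hy : E.y - algebraMap k E.FunctionField b ∈ V.nonunits) (p : k[X][X]) :
    aeval E.y p ∈ V.nonunits ↔ p.evalEval a b = 0 := by
  have h := E.aeval_y_sub_mem_nonunits hk hx hy p
  constructor
  · intro hp
    by_contra h0
    have h1 := sub_mem hp h
    rw [sub_sub_cancel, ValuationSubring.mem_nonunits_iff_or, ← map_inv₀] at h1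
    exact h1.elim (by simpa using h0) fun h2 => h2 (hk _)
  · intro h0
    rwa [h0, map_zero, sub_zero] at h

theorem mem_of_sub_mem_nonunits {V : ValuationSubring E.FunctionField}
    (hk : ∀ c : k, algebraMap k E.FunctionField c ∈ V) {a : k}
    (hx : E.x - algebraMap k E.FunctionField a ∈ V.nonunits) : E.x ∈ V ∧ V ≠ ⊤ := by
  constructor
  · have := V.add_mem _ _ (V.nonunits_subset hx) (hk a)
    simpa using this
  · rintro rfl
    rw [ValuationSubring.mem_nonunits_iff_or] at hx
    refine hx.elim (fun h => ?_) fun h => h trivial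
    rw [← E.algebraMap_C, ← E.algebraMap_X, ← map_sub, map_eq_zero_iff _ E.algebraMap_injective] at h
    exact X_sub_C_ne_zero a h

/-- The affine point with given coordinates is unique. -/
theorem IsAffinePoint.ring_eq {E : Curve k n d} {P : E.Point} {a b : k} (hP : E.IsAffinePoint P a b)
    {V : ValuationSubring E.FunctionField} (hk : ∀ c : k, algebraMap k E.FunctionField c ∈ V)
    (hx : E.x - algebraMap k E.FunctionField a ∈ V.nonunits)
    (hy : E.y - algebraMap k E.FunctionField b ∈ V.nonunits) : V = P.ring := by
  have h1 := E.mem_of_sub_mem_nonunits hk hx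
  have h2 := E.mem_of_sub_mem_nonunits P.algebraMap_mem hP.1
  obtain ⟨v, hv, hv'⟩ := E.exists_heightOneSpectrum hk h1.1 h1.2
  obtain ⟨w, hw, hw'⟩ := E.exists_heightOneSpectrum P.algebraMap_mem h2.1 h2.2
  have hvw : v = w := by
    ext s
    obtain ⟨p, -, hp⟩ := E.exists_aeval_y_eq_of_isIntegral s.2
    rw [hv', hw', ← hp, E.aeval_y_mem_nonunits_iff hk hx hy,
      E.aeval_y_mem_nonunits_iff P.algebraMap_mem hP.1 hP.2]
  rw [← hv, ← hw, hvw]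

theorem IsAffinePoint.eq {E : Curve k n d} {P Q : E.Point} {a b : k} (hP : E.IsAffinePoint P a b)
    (hQ : E.IsAffinePoint Q a b) : P = Q :=
  Place.ext (hQ.ring_eq P.algebraMap_mem hP.1 hP.2)

theorem IsAffinePoint.pow_eq {E : Curve k n d} {P : E.Point} {a b : k}
    (hP : E.IsAffinePoint P a b) : b ^ d = E.poly.eval a := by
  have h := (E.aeval_y_mem_nonunits_iff P.algebraMap_mem hP.1 hP.2 E.affineEquation).1 (by
    rw [(E.aeval_y_eq_zero_iff _).2 dvd_rfl]; exact zero_mem _)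
  simpa [affineEquation, evalEval, sub_eq_zero] using h

/-- The ideal of `(a, b)` contains `Y^d - f`, the generator of the kernel of `k[X][Y] → F`. Its
image in `k[x, y]` is therefore proper and is dominated by some valuation ring. -/
theorem exists_isAffinePoint {a b : k} (h : b ^ d = E.poly.eval a) :
    ∃ P : E.Point, E.IsAffinePoint P a b := by
  let ρ : k[X][X] →+* E.FunctionField := (aeval E.y : k[X][X] →ₐ[k[X]] E.FunctionField).toRingHom
  let J : Ideal k[X][X] := RingHom.ker (evalEvalRingHom a b)
  have hker : RingHom.ker ρ.rangeRestrict ≤ J := by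
    intro p hp
    rw [RingHom.ker_rangeRestrict, RingHom.mem_ker] at hp
    obtain ⟨q, rfl⟩ := (E.aeval_y_eq_zero_iff p).1 hp
    rw [RingHom.mem_ker, map_mul]
    simp [affineEquation, h]
  have hI : J.map ρ.rangeRestrict ≠ ⊤ := by
    rw [Ne, Ideal.map_eq_top_iff_of_ker_le _ hker
      (RingHom.isIntegral_of_surjective _ ρ.rangeRestrict_surjective)]
    exact RingHom.ker_ne_top _
  obtain ⟨V, hV, hIV⟩ := Ideal.image_subset_nonunits_valuationSubring _ hI
  have hk (c : k) : algebraMap k E.FunctionField c ∈ V :=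
    hV ⟨C (C c), by simp [ρ, algebraMap_C]⟩
  have hJ {p : k[X][X]} (hp : p.evalEval a b = 0) : aeval E.y p ∈ V.nonunits :=
    hIV ⟨ρ.rangeRestrict p, Ideal.mem_map_of_mem _ hp, rfl⟩
  have hx : E.x - algebraMap k E.FunctionField a ∈ V.nonunits := by
    have := hJ (p := C (X - C a)) (by simp [evalEval])
    simpa [algebraMap_C, algebraMap_X] using this
  have hy : E.y - algebraMap k E.FunctionField b ∈ V.nonunits := by
    have := hJ (p := X - C (C b)) (by simp [evalEval])
    simpa [algebraMap_C, algebraMap_X] using this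
  have h1 := E.mem_of_sub_mem_nonunits hk hx
  exact ⟨E.pointOfValuationSubring V hk h1.1 h1.2, hx, hy⟩

/-- A regular function is a quotient `q/p` of polynomials with `p(a, b) ≠ 0`, and its value is `q(a,
b)/p(a, b)`. -/
theorem IsAffinePoint.isRational {E : Curve k n d} {P : E.Point} {a b : k}
    (hP : E.IsAffinePoint P a b) : P.IsRational := by
  intro g hg
  have h1 := E.mem_of_sub_mem_nonunits P.algebraMap_mem hP.1
  obtain ⟨v, hv, hv'⟩ := E.exists_heightOneSpectrum P.algebraMap_mem h1.1 h1.2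
  rw [← hv, Valuation.mem_valuationSubring_iff] at hg
  obtain ⟨t, s, hst⟩ := v.exists_primeCompl_mul_eq_of_integer g hg
  obtain ⟨q, -, hq⟩ := E.exists_aeval_y_eq_of_isIntegral t.2
  obtain ⟨p, -, hp⟩ := E.exists_aeval_y_eq_of_isIntegral s.1.2
  have hs : aeval E.y p ∉ P.ring.nonunits := by
    rw [hp, ← hv']; exact s.2
  have hs' := hs
  rw [E.aeval_y_mem_nonunits_iff P.algebraMap_mem hP.1 hP.2] at hs'
  rw [ValuationSubring.mem_nonunits_iff_or, not_or, not_not] at hs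
  refine ⟨q.evalEval a b / p.evalEval a b, ?_⟩
  set c := q.evalEval a b / p.evalEval a b with hc
  have h2 : aeval E.y (q - C (C c) * p) ∈ P.ring.nonunits := by
    rw [E.aeval_y_mem_nonunits_iff P.algebraMap_mem hP.1 hP.2]
    simp [evalEval_sub, evalEval_mul, hc, hs']
  have h3 : g - algebraMap k E.FunctionField c =
      aeval E.y (q - C (C c) * p) * (aeval E.y p)⁻¹ := by
    have hst' : g * aeval E.y p = aeval E.y q := by rw [hp, hq]; exact hst
    rw [eq_mul_inv_iff_mul_eq₀ hs.1, map_sub, ← hst', map_mul, aeval_C, algebraMap_C]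
    ring
  rw [Place.HasValue, Place.Vanishes, h3, ValuationSubring.mem_nonunits_iff, map_mul]
  exact mul_lt_one_of_lt_of_le ((P.ring.mem_nonunits_iff).1 h2) ((P.ring.valuation_le_one_iff _).2 hs.2)

/-- A function without poles in the affine part is a polynomial in `x` and `y`. -/
theorem exists_aeval_y_eq_of_forall_mem {g : E.FunctionField}
    (h : ∀ P : E.Point, E.x ∈ P.ring → g ∈ P.ring) :
    ∃ p : k[X][X], p.natDegree < d ∧ aeval E.y p = g := by
  obtain ⟨s, rfl⟩ := IsDedekindDomain.HeightOneSpectrum.mem_integers_of_valuation_le_one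
      (R := integralClosure k[X] E.FunctionField) E.FunctionField g fun v => by
    have hmem (u : k[X]) : algebraMap k[X] E.FunctionField u ∈
        (v.valuation E.FunctionField).valuationSubring :=
      v.valuation_le_one (algebraMap k[X] (integralClosure k[X] E.FunctionField) u)
    refine h ⟨(v.valuation E.FunctionField).valuationSubring, fun c => ?_,
      isDiscreteValuationRing_adic v⟩ ?_
    · rw [← algebraMap_C]; exact hmem _
    · rw [← algebraMap_X]; exact hmem _
  exact E.exists_aeval_y_eq_of_isIntegral s.2

end Curve

/-! ### The point at infinity. -/

namespace Curve

variable {k : Type*} [Field k] {n d : ℕ} (E : Curve k n d)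

theorem exists_eq_div (g : E.FunctionField) (hg : g ≠ 0) :
    ∃ p q : k[X][X], p.natDegree < d ∧ q.natDegree < d ∧ p ≠ 0 ∧ q ≠ 0 ∧
      g = aeval E.y p / aeval E.y q := by
  obtain ⟨s, t, ht, rfl⟩ := IsFractionRing.div_surjective (integralClosure k[X] E.FunctionField) g
  obtain ⟨p, hpd, hp⟩ := E.exists_aeval_y_eq_of_isIntegral s.2
  obtain ⟨q, hqd, hq⟩ := E.exists_aeval_y_eq_of_isIntegral t.2
  have h1 : algebraMap (integralClosure k[X] E.FunctionField) E.FunctionField s = aeval E.y p :=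
    hp.symm
  have h2 : algebraMap (integralClosure k[X] E.FunctionField) E.FunctionField t = aeval E.y q :=
    hq.symm
  rw [h1, h2] at hg ⊢
  refine ⟨p, q, hpd, hqd, ?_, ?_, rfl⟩ <;> rintro rfl <;> simp at hg

/-- The order of the pole at infinity of a polynomial in `x` and `y`. -/
def poleOrder (_ : Curve k n d) (p : k[X][X]) : ℕ :=
  p.support.sup fun j => d * (p.coeff j).natDegree + n * j

theorem le_poleOrder {p : k[X][X]} {j : ℕ} (hj : p.coeff j ≠ 0) :
    d * (p.coeff j).natDegree + n * j ≤ E.poleOrder p :=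
  Finset.le_sup (f := fun j => d * (p.coeff j).natDegree + n * j) (mem_support_iff.2 hj)

theorem poleOrder_C (u : k[X]) : E.poleOrder (C u) = d * u.natDegree := by
  by_cases hu : u = 0
  · simp [hu, poleOrder]
  · simp [poleOrder, support_C hu]

/-- The inverse of a local parameter at infinity. -/
def infParameter : E.FunctionField := E.x ^ (Nat.gcdA d n) * E.y ^ (Nat.gcdB d n)

section Valuation

variable {Γ₀ : Type*} [LinearOrderedCommGroupWithZero Γ₀] {v : Valuation E.FunctionField Γ₀}

theorem valuation_algebraMap_of_one_lt (hv : ∀ c : k, c ≠ 0 → v (algebraMap k _ c) = 1)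
    (hx : 1 < v E.x) {u : k[X]} (hu : u ≠ 0) :
    v (algebraMap k[X] E.FunctionField u) = v E.x ^ u.natDegree := by
  rw [← aeval_x, aeval_def, eval₂_eq_sum, Polynomial.sum]
  have hterm {i : ℕ} (hi : i ∈ u.support) :
      v (algebraMap k E.FunctionField (u.coeff i) * E.x ^ i) = v E.x ^ i := by
    rw [map_mul, hv _ (mem_support_iff.1 hi), one_mul, map_pow]
  have hdeg := natDegree_mem_support_of_nonzero hu
  rw [Valuation.map_sum_eq_of_lt v hdeg (fun i hi => ?_), hterm hdeg]
  rw [Finset.mem_sdiff, Finset.mem_singleton] at hi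
  rw [hterm hi.1, hterm hdeg]
  exact pow_lt_pow_right₀ hx (lt_of_le_of_ne (le_natDegree_of_mem_supp _ hi.1) hi.2)

theorem valuation_y_pow (hv : ∀ c : k, c ≠ 0 → v (algebraMap k _ c) = 1) (hx : 1 < v E.x) :
    v E.y ^ d = v E.x ^ n := by
  rw [← map_pow, y_pow, E.valuation_algebraMap_of_one_lt hv hx E.poly_ne_zero, E.natDegree_poly]

theorem valuation_infParameter (hv : ∀ c : k, c ≠ 0 → v (algebraMap k _ c) = 1)
    (hx : 1 < v E.x) :
    v E.infParameter ^ d = v E.x ∧ v E.infParameter ^ n = v E.y ∧ 1 < v E.infParameter := by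
  have hx0 : v E.x ≠ 0 := (_root_.map_ne_zero _).2 E.x_ne_zero
  have hy0 : v E.y ≠ 0 := (_root_.map_ne_zero _).2 E.y_ne_zero
  -- Bézout combined with `v(y)^d = v(x)^n` yields both power relations.
  have hg : (d : ℤ) * Nat.gcdA d n + n * Nat.gcdB d n = 1 := by
    rw [← Nat.gcd_eq_gcd_ab, Nat.Coprime.gcd_eq_one E.coprime.symm]; rfl
  have h := E.valuation_y_pow hv hx
  have h1 : v E.infParameter ^ d = v E.x := by
    rw [infParameter, map_mul, map_zpow₀, map_zpow₀, mul_pow, ← zpow_natCast (v E.y ^ _),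
      zpow_comm, zpow_natCast, h, ← zpow_natCast, ← zpow_natCast, ← zpow_mul, ← zpow_mul,
      ← zpow_add₀ hx0, mul_comm _ (d : ℤ), hg, zpow_one]
  have h2 : v E.infParameter ^ n = v E.y := by
    rw [infParameter, map_mul, map_zpow₀, map_zpow₀, mul_pow, ← zpow_natCast (v E.x ^ _),
      zpow_comm, zpow_natCast, ← h, ← zpow_natCast, ← zpow_natCast, ← zpow_mul, ← zpow_mul,
      ← zpow_add₀ hy0, mul_comm _ (n : ℤ), hg, zpow_one]
  refine ⟨h1, h2, ?_⟩
  rw [← h1] at hx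
  exact (one_lt_pow_iff E.d_ne_zero).1 hx

/-- The orders `d i + n j` with `0 ≤ j < d` determine `j` modulo `d`, hence `j`. A single term thus
dominates the sum. -/
theorem valuation_aeval_y (hv : ∀ c : k, c ≠ 0 → v (algebraMap k _ c) = 1) (hx : 1 < v E.x)
    {p : k[X][X]} (hp : p ≠ 0) (hpd : p.natDegree < d) :
    v (aeval E.y p) = v E.infParameter ^ E.poleOrder p := by
  obtain ⟨h1, h2, h3⟩ := E.valuation_infParameter hv hx
  have hterm {i : ℕ} (hi : i ∈ p.support) :
      v (algebraMap k[X] E.FunctionField (p.coeff i) * E.y ^ i) =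
        v E.infParameter ^ (d * (p.coeff i).natDegree + n * i) := by
    rw [map_mul, E.valuation_algebraMap_of_one_lt hv hx (mem_support_iff.1 hi), map_pow,
      ← h1, ← h2, pow_add, pow_mul, pow_mul]
  obtain ⟨j, hj, hmax⟩ := Finset.exists_mem_eq_sup p.support (support_nonempty.2 hp)
    fun j => d * (p.coeff j).natDegree + n * j
  rw [aeval_def, eval₂_eq_sum, Polynomial.sum, Valuation.map_sum_eq_of_lt v hj (fun i hi => ?_),
    hterm hj, poleOrder, hmax]
  rw [Finset.mem_sdiff, Finset.mem_singleton] at hi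
  rw [hterm hi.1, hterm hj]
  refine pow_lt_pow_right₀ h3 (lt_of_le_of_ne ?_ fun h => hi.2 ?_)
  · rw [← hmax]
    exact Finset.le_sup (f := fun j => d * (p.coeff j).natDegree + n * j) hi.1
  · have hmod : n * i ≡ n * j [MOD d] := by
      have := congrArg (· % d) h
      simpa [Nat.ModEq, Nat.mul_add_mod] using this
    have := Nat.ModEq.cancel_left_of_coprime (by simpa [Nat.Coprime] using E.coprime.symm) hmod
    exact Nat.ModEq.eq_of_lt_of_lt this ((le_natDegree_of_mem_supp _ hi.1).trans_lt hpd)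
      ((le_natDegree_of_mem_supp _ hj).trans_lt hpd)

end Valuation

-- All values are powers of the value of `infParameter`. Once `exp (-1)` is attained, the logarithm
-- of that value is a unit of `ℤ`, and it is positive.
open scoped WithZero in
theorem valuation_infParameter_eq_exp_one {v : Valuation E.FunctionField ℤᵐ⁰}
    (hv : ∀ c : k, c ≠ 0 → v (algebraMap k _ c) = 1) (hx : 1 < v E.x) {g : E.FunctionField}
    (hg : v g = WithZero.exp (-1)) : v E.infParameter = WithZero.exp 1 := by
  have hg0 : g ≠ 0 := by
    rintro rfl; rw [map_zero] at hg; exact WithZero.exp_ne_zero hg.symm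
  obtain ⟨p, q, hpd, hqd, hp, hq, rfl⟩ := E.exists_eq_div g hg0
  obtain ⟨-, -, h3⟩ := E.valuation_infParameter hv hx
  have h0 : v E.infParameter ≠ 0 := (zero_lt_one.trans h3).ne'
  rw [map_div₀, E.valuation_aeval_y hv hx hp hpd, E.valuation_aeval_y hv hx hq hqd] at hg
  rw [← WithZero.exp_log h0] at h3 hg ⊢
  rw [← WithZero.exp_zero, WithZero.exp_lt_exp] at h3
  rw [← WithZero.exp_nsmul, ← WithZero.exp_nsmul, ← WithZero.exp_sub, WithZero.exp_inj] at hg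
  simp only [nsmul_eq_mul] at hg
  have hu : IsUnit (WithZero.log (v E.infParameter)) :=
    IsUnit.of_mul_eq_one ((E.poleOrder q : ℤ) - E.poleOrder p) (by linarith)
  rw [WithZero.exp_inj]
  rcases Int.isUnit_iff.1 hu with h | h <;> omega

namespace IsInfinity

variable {E} {O : E.Point}

theorem one_lt_valuation (hO : E.IsInfinity O) : 1 < O.valuation E.x := by
  rw [← not_le, O.valuation_le_one_iff]; exact hO

theorem ord_infParameter (hO : E.IsInfinity O) : O.ord E.infParameter = -1 := by
  obtain ⟨g, hg0, hg⟩ := O.exists_ord_eq_one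
  rw [Place.ord_eq, E.valuation_infParameter_eq_exp_one (fun c hc => O.valuation_algebraMap hc)
    hO.one_lt_valuation (g := g) (by rw [O.valuation_eq_exp hg0, hg]), WithZero.log_exp]

theorem ord_aeval_y (hO : E.IsInfinity O) {p : k[X][X]} (hp : p ≠ 0) (hpd : p.natDegree < d) :
    O.ord (aeval E.y p) = -E.poleOrder p := by
  have hv (c : k) (hc : c ≠ 0) := O.valuation_algebraMap hc
  have h := hO.ord_infParameter
  rw [Place.ord_eq, E.valuation_aeval_y hv hO.one_lt_valuation hp hpd, WithZero.log_pow]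
  rw [Place.ord_eq, neg_inj] at h
  rw [h]; simp

theorem ord_algebraMap (hO : E.IsInfinity O) {u : k[X]} (hu : u ≠ 0) :
    O.ord (algebraMap k[X] E.FunctionField u) = -(d * u.natDegree) := by
  have := hO.ord_aeval_y (p := C u) (by simpa using hu) (by
    rw [natDegree_C]; exact Nat.pos_of_ne_zero E.d_ne_zero)
  rw [aeval_C, poleOrder_C] at this
  exact_mod_cast this

/-- The point at infinity is unique. -/
theorem eq (hO : E.IsInfinity O) {O' : E.Point} (hO' : E.IsInfinity O') : O = O' := by
  refine Place.ext (ValuationSubring.ext _ _ fun g => ?_)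
  by_cases hg : g = 0
  · simp [hg, zero_mem]
  · obtain ⟨p, q, hpd, hqd, hp, hq, rfl⟩ := E.exists_eq_div g hg
    rw [← Place.ord_nonneg_iff _ hg, ← Place.ord_nonneg_iff _ hg]
    rw [← Ne, div_ne_zero_iff] at hg
    rw [div_eq_mul_inv, Place.ord_mul _ hg.1 (inv_ne_zero hg.2),
      Place.ord_mul _ hg.1 (inv_ne_zero hg.2), Place.ord_inv, Place.ord_inv, hO.ord_aeval_y hp hpd,
      hO.ord_aeval_y hq hqd, hO'.ord_aeval_y hp hpd, hO'.ord_aeval_y hq hqd]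

end IsInfinity

/-- The value group is generated by the value of `infParameter`, so the inverse of that function is
a uniformizer. This turns any valuation ring over `k` without `x` into a place. -/
theorem isDiscreteValuationRing_of_x_notMem {V : ValuationSubring E.FunctionField}
    (hk : ∀ c : k, algebraMap k E.FunctionField c ∈ V) (hx : E.x ∉ V) :
    IsDiscreteValuationRing V := by
  have hx' : 1 < V.valuation E.x := by
    rw [← not_le, V.valuation_le_one_iff]; exact hx
  have hv (c : k) (hc : c ≠ 0) : V.valuation (algebraMap k E.FunctionField c) = 1 := by
    refine le_antisymm ((V.valuation_le_one_iff _).2 (hk c)) ?_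
    have h := (V.valuation_le_one_iff _).2 (hk c⁻¹)
    rw [map_inv₀, map_inv₀] at h
    exact (inv_le_one₀ (zero_lt_iff.2 ((_root_.map_ne_zero _).2 (by simpa using hc)))).1 h
  obtain ⟨-, -, h3⟩ := E.valuation_infParameter hv hx'
  have h0 : 0 < V.valuation E.infParameter := zero_lt_one.trans h3
  have hz (g : E.FunctionField) (hg : g ≠ 0) :
      ∃ m : ℤ, V.valuation g = V.valuation E.infParameter ^ m := by
    obtain ⟨p, q, hpd, hqd, hp, hq, rfl⟩ := E.exists_eq_div g hg
    refine ⟨E.poleOrder p - E.poleOrder q, ?_⟩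
    rw [map_div₀, E.valuation_aeval_y hv hx' hp hpd, E.valuation_aeval_y hv hx' hq hqd,
      zpow_sub₀ h0.ne', zpow_natCast, zpow_natCast]
  have hn (g : V) (hg : g ≠ 0) :
      ∃ m : ℕ, V.valuation (g : E.FunctionField) = (V.valuation E.infParameter)⁻¹ ^ m := by
    obtain ⟨m, hm⟩ := hz g (by simpa using hg)
    have h1 := (V.valuation_le_one_iff _).2 g.2
    rw [hm, zpow_le_one_iff_right₀ h3] at h1
    refine ⟨(-m).toNat, ?_⟩
    rw [hm, ← zpow_natCast, Int.toNat_of_nonneg (by omega), inv_zpow, zpow_neg, inv_inv]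
  have hlt : (V.valuation E.infParameter)⁻¹ < 1 := inv_lt_one_of_one_lt₀ h3
  have hpow := pow_right_injective₀ (inv_pos.2 h0) hlt.ne
  let t : V := ⟨E.infParameter⁻¹, by
    rw [← V.valuation_le_one_iff, map_inv₀]; exact hlt.le⟩
  have ht : V.valuation (t : E.FunctionField) = (V.valuation E.infParameter)⁻¹ := map_inv₀ _ _
  refine IsDiscreteValuationRing.ofHasUnitMulPowIrreducibleFactorization ⟨t, ⟨?_, ?_⟩, ?_⟩
  · rw [V.valuation_eq_one_iff, ht]; exact hlt.ne
  · intro a b hab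
    have hab' := congrArg (fun z : V => V.valuation (z : E.FunctionField)) hab
    have ha : a ≠ 0 := by
      rintro rfl
      rw [zero_mul] at hab; rw [hab] at ht
      exact h0.ne (by simpa using ht)
    have hb : b ≠ 0 := by
      rintro rfl
      rw [mul_zero] at hab; rw [hab] at ht
      exact h0.ne (by simpa using ht)
    obtain ⟨i, hi⟩ := hn a ha
    obtain ⟨j, hj⟩ := hn b hb
    have h1 : (V.valuation E.infParameter)⁻¹ ^ 1 = (V.valuation E.infParameter)⁻¹ ^ (i + j) := by
      rw [pow_add, ← hi, ← hj, ← map_mul, pow_one, ← ht, hab]; rfl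
    have h2 := hpow h1
    rw [V.valuation_eq_one_iff, V.valuation_eq_one_iff, hi, hj]
    rcases (by omega : i = 0 ∨ j = 0) with rfl | rfl <;> simp
  · intro g hg
    obtain ⟨m, hm⟩ := hn g hg
    refine ⟨m, ?_⟩
    have h1 : V.valuation (g : E.FunctionField) = V.valuation ((t ^ m : V) : E.FunctionField) := by
      rw [hm, ← ht, ← map_pow]; rfl
    obtain ⟨a, ha⟩ := (V.valuation_eq_iff _ _).1 h1
    refine ⟨a, Subtype.ext ?_⟩
    rw [← ha, mul_comm]; rfl

/-- A valuation ring dominating the ideal `(1/x)` of `k[1/x]` does not contain `x`. -/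
theorem exists_isInfinity : ∃ O : E.Point, E.IsInfinity O := by
  let ρ : k[X] →+* E.FunctionField := (aeval E.x⁻¹ : k[X] →ₐ[k] E.FunctionField).toRingHom
  have hinj : Function.Injective ρ := by
    have h : Transcendental k E.x := by
      rw [transcendental_iff_injective]
      intro u w h
      rw [aeval_x, aeval_x] at h
      exact E.algebraMap_injective h
    exact transcendental_iff_injective.1 fun h' => h (by simpa using h'.inv)
  have hI : (RingHom.ker (evalRingHom (0 : k))).map ρ.rangeRestrict ≠ ⊤ := by
    rw [Ne, Ideal.map_eq_top_iff_of_ker_le _ _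
      (RingHom.isIntegral_of_surjective _ ρ.rangeRestrict_surjective)]
    · exact RingHom.ker_ne_top _
    · rw [RingHom.ker_rangeRestrict, (RingHom.injective_iff_ker_eq_bot ρ).1 hinj]
      exact bot_le
  obtain ⟨V, hV, hIV⟩ := Ideal.image_subset_nonunits_valuationSubring _ hI
  have hk (c : k) : algebraMap k E.FunctionField c ∈ V := hV ⟨C c, by simp [ρ]⟩
  have hx : E.x ∉ V := by
    have h : E.x⁻¹ ∈ V.nonunits := hIV ⟨ρ.rangeRestrict X, Ideal.mem_map_of_mem _ (by simp), aeval_X _⟩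
    rw [V.inv_mem_nonunits_iff] at h
    exact h.resolve_left E.x_ne_zero
  exact ⟨⟨V, hk, E.isDiscreteValuationRing_of_x_notMem hk hx⟩, hx⟩

end Curve

/-! ### Principal multiples and bounds for `m₀`. -/

theorem nsmul_toJacobian_eq_zero_iff {k F : Type*} [Field k] [IsAlgClosed k] [Field F] [Algebra k F]
    {O P : Place k F} {m : ℕ} : m • toJacobian O P = 0 ↔
      ∃ h : F, h ≠ 0 ∧ ∀ Q, (m : ℤ) * ((Finsupp.single P 1 : Place k F →₀ ℤ) Q -
        (Finsupp.single O 1 : Place k F →₀ ℤ) Q) = Q.ord h := by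
  rw [toJacobian, ← QuotientAddGroup.mk_nsmul, QuotientAddGroup.eq_zero_iff]
  refine exists_congr fun h => and_congr_right fun _ => forall_congr' fun Q => ?_
  simp

theorem eq_C_mul_X_sub_C_pow {K : Type*} [Field K] [IsAlgClosed K] {u : K[X]} {a : K}
    (h : ∀ c, u.eval c = 0 → c = a) : u = C u.leadingCoeff * (X - C a) ^ u.natDegree := by
  by_cases hu : u = 0
  · simp [hu]
  have hs := IsAlgClosed.splits u
  have h1 : u.roots = Multiset.replicate u.natDegree a :=
    Multiset.eq_replicate.2 ⟨hs.natDegree_eq_card_roots.symm, fun c hc => h c ((mem_roots hu).1 hc)⟩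
  conv_lhs => rw [hs.eq_prod_roots, h1]
  simp

/-- `m₀` is the least multiple of `d` above `n`. With `m0_lt`, this decides which monomials can
occur in a function with a pole of order `m₀`. -/
theorem lt_m0 {k : Type*} [Field k] {n d : ℕ} (E : Curve k n d) : n < m0 n d := by
  have := E.two_le
  rw [m0, ell0, Nat.add_div_right _ (by omega)]
  exact Nat.lt_mul_div_succ n (by omega)

theorem m0_lt {k : Type*} [Field k] {n d : ℕ} (E : Curve k n d) : m0 n d < n + d := by
  have h2 := E.two_le
  rw [m0]
  refine lt_of_le_of_ne (Nat.mul_div_le _ _) fun h => ?_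
  have h1 : d ∣ n := by
    rw [← Nat.dvd_add_left (dvd_refl d), ← h]; exact dvd_mul_right _ _
  have := Nat.eq_one_of_dvd_coprimes E.coprime h1 dvd_rfl
  omega

/-! ### The divisor of `y - w(x)`. -/

namespace Curve

section

variable {k : Type*} [Field k] {n d : ℕ} {E : Curve k n d}

theorem not_dvd (E : Curve k n d) : ¬ d ∣ n := fun h1 => by
  have := Nat.eq_one_of_dvd_coprimes E.coprime h1 dvd_rfl
  have := E.two_le
  omega

theorem IsAffinePoint.aeval_y_vanishes_iff {P : E.Point} {a b : k} (hP : E.IsAffinePoint P a b)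
    (p : k[X][X]) : P.Vanishes (aeval E.y p) ↔ p.evalEval a b = 0 :=
  E.aeval_y_mem_nonunits_iff P.algebraMap_mem hP.1 hP.2 p

theorem IsAffinePoint.algebraMap_vanishes_iff {P : E.Point} {a b : k} (hP : E.IsAffinePoint P a b)
    (u : k[X]) : P.Vanishes (algebraMap k[X] E.FunctionField u) ↔ u.eval a = 0 := by
  have := hP.aeval_y_vanishes_iff (C u)
  rwa [aeval_C, evalEval_C] at this

theorem IsAffinePoint.x_mem {P : E.Point} {a b : k} (hP : E.IsAffinePoint P a b) : E.x ∈ P.ring :=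
  (E.mem_of_sub_mem_nonunits P.algebraMap_mem hP.1).1

theorem IsAffinePoint.ne {P O : E.Point} {a b : k} (hP : E.IsAffinePoint P a b)
    (hO : E.IsInfinity O) : P ≠ O := by
  rintro rfl; exact hO hP.x_mem

theorem IsAffinePoint.coord_eq {P : E.Point} {a b a' b' : k} (hP : E.IsAffinePoint P a b)
    (hP' : E.IsAffinePoint P a' b') : a = a' ∧ b = b' := by
  constructor
  · have := (hP'.algebraMap_vanishes_iff (X - C a)).1 (by
      rw [hP.algebraMap_vanishes_iff]; simp)
    simpa [sub_eq_zero, eq_comm] using this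
  · have := (hP'.aeval_y_vanishes_iff (X - C (C b))).1 (by
      rw [hP.aeval_y_vanishes_iff]; simp [evalEval])
    simpa [evalEval, sub_eq_zero, eq_comm] using this

/-- `S` is the cofactor of `y - w` in `y^d - w^d`. It is a unit at `(a, w(a))` when `w(a) ≠ 0`, so
there `y - w` and `f - w^d` have the same order. -/
theorem exists_mul_y_sub_eq (E : Curve k n d) (w : k[X]) : ∃ S : k[X][X],
    aeval E.y S * (E.y - algebraMap k[X] E.FunctionField w) =
      algebraMap k[X] E.FunctionField (E.poly - w ^ d) ∧
    ∀ a, S.evalEval a (w.eval a) = d * w.eval a ^ (d - 1) := by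
  refine ⟨∑ i ∈ Finset.range d, X ^ i * C w ^ (d - 1 - i), ?_, fun a => ?_⟩
  · have h := (Commute.all E.y (algebraMap k[X] E.FunctionField w)).geom_sum₂_mul d
    rw [map_sub, map_pow, ← y_pow, ← h]
    simp
  · rw [evalEval, eval_finsetSum, eval_finsetSum, Finset.sum_congr rfl (fun i hi => ?_),
      Finset.sum_const, Finset.card_range, nsmul_eq_mul]
    have : i + (d - 1 - i) = d - 1 := by
      have := Finset.mem_range.1 hi; omega
    rw [← this, pow_add]
    simp

/-- The function `x - a` is a local parameter at `(a, b)` if `b ≠ 0`. -/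
theorem IsAffinePoint.ord_X_sub_C {P : E.Point} {a b : k} (hP : E.IsAffinePoint P a b)
    (hb : b ≠ 0) : P.ord (algebraMap k[X] E.FunctionField (X - C a)) = 1 := by
  set t := algebraMap k[X] E.FunctionField (X - C a) with ht
  have ht0 : t ≠ 0 := by
    rw [ht, map_ne_zero_iff _ E.algebraMap_injective]; exact X_sub_C_ne_zero a
  have hpos : 0 < P.ord t := by
    rw [P.ord_pos_iff ht0, hP.algebraMap_vanishes_iff]; simp
  have hx := hP.x_mem
  have hmem (p : k[X][X]) : P.valuation (aeval E.y p) ≤ 1 :=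
    P.valuation_le_one_iff.2 (E.aeval_y_mem P.algebraMap_mem hx p)
  have hmem' (u : k[X]) : P.valuation (algebraMap k[X] E.FunctionField u) ≤ 1 := by
    have := hmem (C u); rwa [aeval_C] at this
  have hunit {p : k[X][X]} (hp : p.evalEval a b ≠ 0) : P.valuation (aeval E.y p) = 1 :=
    le_antisymm (hmem p) (not_lt.1 (by
      rw [P.valuation_lt_one_iff, hP.aeval_y_vanishes_iff]; exact hp))
  -- `x - a` divides `f - b^d = S (y - b)`, and `S` is a unit at `P`.
  have hy : P.valuation (E.y - algebraMap k[X] E.FunctionField (C b)) ≤ P.valuation t := by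
    obtain ⟨S, hS, hS'⟩ := E.exists_mul_y_sub_eq (C b)
    have hS1 := hunit (p := S) (by
      have := hS' a
      rw [eval_C] at this
      rw [this]
      exact mul_ne_zero E.cast_ne_zero (pow_ne_zero _ hb))
    obtain ⟨q, hq⟩ : X - C a ∣ E.poly - C b ^ d := by
      rw [dvd_iff_isRoot]; simp [hP.pow_eq]
    have := congrArg P.valuation hS
    rw [map_mul, hS1, one_mul, hq, map_mul, map_mul] at this
    rw [this]
    exact mul_le_of_le_one_right' (hmem' q)
  -- A uniformizer is, up to a unit, a polynomial vanishing at `(a, b)`; its first-order expansion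
  -- shows that it vanishes at least as much as `x - a`.
  obtain ⟨g, hg0, hg⟩ := P.exists_ord_eq_one
  obtain ⟨v, hv, hv'⟩ := E.exists_heightOneSpectrum P.algebraMap_mem hx P.ring_ne_top
  have hgv : g ∈ P.ring := by rw [← P.ord_nonneg_iff hg0]; omega
  rw [← hv, Valuation.mem_valuationSubring_iff] at hgv
  obtain ⟨s, r, hrs⟩ := v.exists_primeCompl_mul_eq_of_integer g hgv
  obtain ⟨q, -, hq⟩ := E.exists_aeval_y_eq_of_isIntegral s.2
  obtain ⟨p, -, hp⟩ := E.exists_aeval_y_eq_of_isIntegral r.1.2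
  have hr : aeval E.y p ∉ P.ring.nonunits := by rw [hp, ← hv']; exact r.2
  have hp0 : p.evalEval a b ≠ 0 := by
    rwa [← Place.Vanishes, hP.aeval_y_vanishes_iff] at hr
  have hgq : g * aeval E.y p = aeval E.y q := by rw [hp, hq]; exact hrs
  have hgq' := congrArg P.valuation hgq
  rw [map_mul, hunit hp0, mul_one] at hgq'
  have hq0 : q.evalEval a b = 0 := by
    rw [← hP.aeval_y_vanishes_iff, ← P.valuation_lt_one_iff, ← hgq', P.valuation_lt_one_iff,
      ← P.ord_pos_iff hg0]
    omega
  have hle : P.valuation g ≤ P.valuation t := by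
    obtain ⟨u, r, h⟩ := exists_eq_add_mul_add_mul q a b
    rw [hgq', h, hq0, C_0, C_0, zero_add, map_add, aeval_C, map_mul (aeval E.y),
      map_mul (algebraMap k[X] E.FunctionField), map_sub (aeval E.y) (X : k[X][X]),
      aeval_X, aeval_C]
    refine (Valuation.map_add _ _ _).trans (max_le ?_ ?_)
    · rw [map_mul]; exact mul_le_of_le_one_right' (hmem' u)
    · rw [map_mul]; exact (mul_le_of_le_one_right' (hmem r)).trans hy
  rw [P.valuation_eq_exp hg0, P.valuation_eq_exp ht0, WithZero.exp_le_exp, hg] at hle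
  omega

/-- The equation of a curve for which the function `y - w(x)` has a zero of order `m₀` at the point
`(a, w(a))`. -/
def IsTangentForm (n d : ℕ) (f : k[X]) (a b : k) (w : k[X]) : Prop :=
  w.natDegree = ell0 n d ∧ w.eval a = b ∧
    f = w ^ d - C (w.leadingCoeff ^ d) * (X - C a) ^ m0 n d

theorem IsTangentForm.ne_zero {a b : k} {w : k[X]} (hw : IsTangentForm n d E.poly a b w) :
    w ≠ 0 := by
  rintro rfl
  apply E.poly_ne_zero
  rw [hw.2.2]
  simp [E.d_ne_zero]

/-- With `b = 0`, both terms of `f` would be divisible by `(x - a)^2`, against separability. -/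
theorem IsTangentForm.b_ne_zero {a b : k} {w : k[X]} (hw : IsTangentForm n d E.poly a b w) :
    b ≠ 0 := by
  rintro rfl
  obtain ⟨q, hq⟩ := dvd_iff_isRoot.2 hw.2.1
  have h1 := E.separable.squarefree (X - C a) (by
    rw [hw.2.2, ← pow_two, hq]
    refine dvd_sub ?_ (Dvd.dvd.mul_left (pow_dvd_pow _ ?_) _)
    · rw [mul_pow]
      exact Dvd.dvd.mul_right (pow_dvd_pow _ E.two_le) _
    · have := lt_m0 E; have := E.lt; have := E.two_le; omega)
  exact not_isUnit_X_sub_C a h1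

theorem IsInfinity.ord_y_sub {O : E.Point} (hO : E.IsInfinity O) (w : k[X]) :
    O.ord (E.y - algebraMap k[X] E.FunctionField w) = -max (n : ℤ) (d * w.natDegree) := by
  have h2 : O.valuation E.y = WithZero.exp (n : ℤ) := by
    have hd : 1 < d := E.two_le
    have h := hO.ord_aeval_y (p := X) X_ne_zero (by rwa [natDegree_X])
    rw [aeval_X] at h
    rw [O.valuation_eq_exp E.y_ne_zero, h, poleOrder, support_X]
    simp
  rw [Place.ord_eq]
  -- Here `natDegree 0 = 0` makes the maximum equal to `n`, the correct pole order of `y`.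
  by_cases hw : w = 0
  · simp [hw, h2]
  have h1 : O.valuation (algebraMap k[X] E.FunctionField w) =
      WithZero.exp ((d * w.natDegree : ℤ)) := by
    rw [O.valuation_eq_exp ((map_ne_zero_iff _ E.algebraMap_injective).2 hw), hO.ord_algebraMap hw,
      neg_neg]
  -- Since `d ∤ n`, the two pole orders differ and the larger one survives.
  have hne : (n : ℤ) ≠ d * w.natDegree := by
    intro h
    exact E.not_dvd ⟨w.natDegree, by exact_mod_cast h⟩
  rcases lt_or_gt_of_ne hne with h | h
  · rw [Valuation.map_sub_eq_of_lt_right, h1, WithZero.log_exp, max_eq_right h.le]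
    rwa [h1, h2, WithZero.exp_lt_exp]
  · rw [Valuation.map_sub_eq_of_lt_left, h2, WithZero.log_exp, max_eq_left h.le]
    rwa [h1, h2, WithZero.exp_lt_exp]

theorem y_sub_ne_zero (E : Curve k n d) (w : k[X]) : E.y - algebraMap k[X] E.FunctionField w ≠ 0 := by
  intro h
  have h1 : aeval E.y (X - C w) = 0 := by simpa using h
  rw [aeval_y_eq_zero_iff] at h1
  have := natDegree_le_of_dvd h1 (X_sub_C_ne_zero w)
  rw [natDegree_affineEquation, natDegree_X_sub_C] at this
  have := E.two_le
  omega

/-- The divisor of the function `y - w(x)` is `m₀ (P) - m₀ (O)`. -/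
theorem IsTangentForm.ord_eq {a b : k} {w : k[X]} (hw : IsTangentForm n d E.poly a b w)
    {O P : E.Point} (hO : E.IsInfinity O) (hP : E.IsAffinePoint P a b) (Q : E.Point) :
    (m0 n d : ℤ) * ((Finsupp.single P 1 : E.Point →₀ ℤ) Q - (Finsupp.single O 1 : E.Point →₀ ℤ) Q) =
      Q.ord (E.y - algebraMap k[X] E.FunctionField w) := by
  classical
  obtain ⟨S, hS, hS'⟩ := E.exists_mul_y_sub_eq w
  have hne := E.y_sub_ne_zero w
  have hlc : w.leadingCoeff ^ d ≠ 0 := pow_ne_zero _ (leadingCoeff_ne_zero.2 hw.ne_zero)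
  have heq : aeval E.y S * (E.y - algebraMap k[X] E.FunctionField w) =
      -(algebraMap k E.FunctionField (w.leadingCoeff ^ d) *
        algebraMap k[X] E.FunctionField (X - C a) ^ m0 n d) := by
    rw [hS, ← algebraMap_C, ← map_pow, ← map_mul, ← map_neg]
    congr 1
    conv_lhs => rw [hw.2.2]
    ring
  have hS0 : aeval E.y S ≠ 0 := by
    intro h
    rw [h, zero_mul, eq_comm, neg_eq_zero] at heq
    refine mul_ne_zero ?_ (pow_ne_zero _ ?_) heq
    · exact (_root_.map_ne_zero _).2 hlc
    · rw [map_ne_zero_iff _ E.algebraMap_injective]; exact X_sub_C_ne_zero a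
  by_cases hQO : Q = O
  · subst hQO
    rw [hO.ord_y_sub, Finsupp.single_eq_of_ne (hP.ne hO).symm, Finsupp.single_eq_same, hw.1]
    have := lt_m0 E
    rw [max_eq_right (by rw [m0] at this; exact_mod_cast this.le), m0]
    push_cast; ring
  have hx : E.x ∈ Q.ring := by
    by_contra h; exact hQO (IsInfinity.eq h hO)
  rw [Finsupp.single_eq_of_ne hQO, sub_zero]
  by_cases hQP : Q = P
  · subst hQP
    rw [Finsupp.single_eq_same]
    have h1 := congrArg Q.ord heq
    have hb := hw.b_ne_zero
    rw [Q.ord_mul hS0 hne, Q.ord_neg, Q.ord_mul ((_root_.map_ne_zero _).2 hlc) (pow_ne_zero _ (by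
      rw [map_ne_zero_iff _ E.algebraMap_injective]; exact X_sub_C_ne_zero a)),
      Q.ord_algebraMap hlc, Q.ord_pow, hP.ord_X_sub_C hb, Q.ord_eq_zero] at h1
    · linarith
    · exact E.aeval_y_mem Q.algebraMap_mem hx S
    · rw [hP.aeval_y_vanishes_iff, ← hw.2.1, hS', hw.2.1]
      exact mul_ne_zero E.cast_ne_zero (pow_ne_zero _ hb)
  · rw [Finsupp.single_eq_of_ne hQP, mul_zero, Q.ord_eq_zero]
    · have := E.aeval_y_mem Q.algebraMap_mem hx (X - C w)
      simpa using this
    · intro hvan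
      apply hQP
      have hmul {s t : E.FunctionField} (hs : Q.valuation s ≤ 1) (ht : Q.valuation t < 1) :
          Q.valuation (s * t) < 1 := by
        rw [map_mul]; exact mul_lt_one_of_nonneg_of_lt_one_right hs zero_le ht
      have hmem (p : k[X][X]) : Q.valuation (aeval E.y p) ≤ 1 :=
        Q.valuation_le_one_iff.2 (E.aeval_y_mem Q.algebraMap_mem hx p)
      rw [← Q.valuation_lt_one_iff] at hvan
      have h1 := hmul (hmem S) hvan
      rw [heq, Valuation.map_neg, map_mul, Q.valuation_algebraMap hlc, one_mul, map_pow] at h1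
      have h2 : Q.valuation (algebraMap k[X] E.FunctionField (X - C a)) < 1 := by
        by_contra h
        exact h1.not_ge (one_le_pow₀ (not_lt.1 h))
      obtain ⟨q, hq⟩ : X - C a ∣ w - C b := by
        rw [dvd_iff_isRoot]; simp [hw.2.1]
      have h3 : Q.valuation (algebraMap k[X] E.FunctionField (w - C b)) < 1 := by
        rw [hq, mul_comm, map_mul]
        refine hmul ?_ h2
        have := hmem (C q); rwa [aeval_C] at this
      have h4 := (Valuation.map_add Q.valuation _ _).trans_lt (max_lt hvan h3)
      refine IsAffinePoint.eq (a := a) (b := b) ⟨?_, ?_⟩ hP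
      · rw [Place.HasValue, ← Q.valuation_lt_one_iff, ← algebraMap_X, ← algebraMap_C, ← map_sub]
        exact h2
      · rw [Place.HasValue, ← Q.valuation_lt_one_iff, ← algebraMap_C]
        rwa [map_sub, sub_add_sub_cancel] at h4

end

end Curve

/-! ### Orders of points over an algebraically closed field. -/

namespace Curve

section

variable {k : Type*} [Field k] {n d : ℕ} {E : Curve k n d}

theorem exists_aeval_y_eq_of_divisor {O P : E.Point} (hO : E.IsInfinity O) (hPO : P ≠ O)
    {r : ℕ} {g : E.FunctionField} (hg0 : g ≠ 0)
    (hg : ∀ Q : E.Point, (r : ℤ) * ((Finsupp.single P 1 : E.Point →₀ ℤ) Q -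
      (Finsupp.single O 1 : E.Point →₀ ℤ) Q) = Q.ord g) :
    ∃ p : k[X][X], p ≠ 0 ∧ p.natDegree < d ∧ aeval E.y p = g ∧ E.poleOrder p = r := by
  classical
  obtain ⟨p, hpd, rfl⟩ := E.exists_aeval_y_eq_of_forall_mem (g := g) fun Q hQ => by
    have hQO : Q ≠ O := by rintro rfl; exact hO hQ
    rw [← Q.ord_nonneg_iff hg0, ← hg Q, Finsupp.single_eq_of_ne hQO, sub_zero, Finsupp.single_apply]
    split_ifs <;> simp
  have hp : p ≠ 0 := by rintro rfl; simp at hg0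
  refine ⟨p, hp, hpd, rfl, ?_⟩
  have := hg O
  rw [hO.ord_aeval_y hp hpd, Finsupp.single_eq_of_ne hPO.symm, Finsupp.single_eq_same] at this
  omega

theorem eq_of_vanishes_of_divisor {O P : E.Point} {r : ℕ} {g : E.FunctionField} (hg0 : g ≠ 0)
    (hg : ∀ Q : E.Point, (r : ℤ) * ((Finsupp.single P 1 : E.Point →₀ ℤ) Q -
      (Finsupp.single O 1 : E.Point →₀ ℤ) Q) = Q.ord g) {Q : E.Point} (hQ : Q.Vanishes g) :
    Q = P := by
  classical
  by_contra hQP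
  rw [← Q.ord_pos_iff hg0, ← hg Q, Finsupp.single_eq_of_ne hQP, Finsupp.single_apply] at hQ
  split_ifs at hQ <;> omega

end

variable {K : Type*} [Field K] [IsAlgClosed K] {n d : ℕ} {E : Curve K n d}

/-- A function of `x` that vanishes only at one point. -/
theorem eq_zero_of_forall_vanishes {P : E.Point} {a b : K} (hP : E.IsAffinePoint P a b) {u : K[X]}
    (hu : u.natDegree ≠ 0)
    (h : ∀ Q : E.Point, Q.Vanishes (algebraMap K[X] E.FunctionField u) → Q = P) :
    b = 0 ∧ ∀ c, u.eval c = 0 → c = a := by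
  have h1 (c e : K) (hc : u.eval c = 0) (he : e ^ d = E.poly.eval c) : c = a ∧ e = b := by
    obtain ⟨Q, hQ⟩ := E.exists_isAffinePoint he
    rw [h Q ((hQ.algebraMap_vanishes_iff u).2 hc)] at hQ
    exact hQ.coord_eq hP
  have h2 (c : K) (hc : u.eval c = 0) : c = a := by
    obtain ⟨e, he⟩ := IsAlgClosed.exists_pow_nat_eq (E.poly.eval c) (Nat.pos_of_ne_zero E.d_ne_zero)
    exact (h1 c e hc he).1
  refine ⟨?_, h2⟩
  obtain ⟨c, hc⟩ := IsAlgClosed.exists_root u (fun h => hu (natDegree_eq_of_degree_eq_some h))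
  have hca := h2 c hc
  subst hca
  -- For a primitive `d`-th root of unity `ζ`, the point `(c, ζb)` is also a zero, so `ζb = b`.
  have : NeZero (d : K) := ⟨E.cast_ne_zero⟩
  obtain ⟨ζ, hζ⟩ := HasEnoughRootsOfUnity.exists_primitiveRoot K d
  have h3 := (h1 c (ζ * b) hc (by rw [mul_pow, hζ.pow_eq_one, one_mul, hP.pow_eq])).2
  by_contra hb
  exact hζ.ne_one E.two_le (mul_right_cancel₀ hb (h3.trans (one_mul b).symm))

/-- A pole order below `n` excludes `y`. The function is then a polynomial in `x`, which vanishes at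
every `(a, ζb)` with `ζ^d = 1` and not only at `P`. -/
theorem nsmul_toJacobian_ne_zero {O P : E.Point} (hO : E.IsInfinity O) {a b : K}
    (hP : E.IsAffinePoint P a b) (hb : b ≠ 0) {r : ℕ} (hr0 : 0 < r) (hrn : r < n) :
    r • toJacobian O P ≠ 0 := by
  rw [Ne, nsmul_toJacobian_eq_zero_iff]
  rintro ⟨g, hg0, hg⟩
  obtain ⟨p, hp0, -, rfl, hpr⟩ := exists_aeval_y_eq_of_divisor hO (hP.ne hO) hg0 hg
  have hpC : p = C (p.coeff 0) := by
    ext1 j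
    rw [coeff_C]
    split_ifs with h
    · rw [h]
    · by_contra hj
      have h1 := E.le_poleOrder hj
      have h2 : n ≤ n * j := Nat.le_mul_of_pos_right n (Nat.pos_of_ne_zero h)
      omega
  rw [hpC, poleOrder_C] at hpr
  have hQ (Q : E.Point) := eq_of_vanishes_of_divisor hg0 hg (Q := Q)
  rw [hpC, aeval_C] at hQ
  refine hb (eq_zero_of_forall_vanishes hP (fun h => ?_) hQ).1
  rw [h] at hpr
  omega

/-- The order divides `m₀` and is at least `n`, while `m₀ < n + d < 2n`. -/
theorem IsTangentForm.addOrderOf_eq {a b : K} {w : K[X]} (hw : IsTangentForm n d E.poly a b w)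
    {O P : E.Point} (hO : E.IsInfinity O) (hP : E.IsAffinePoint P a b) :
    addOrderOf (toJacobian O P) = m0 n d := by
  have h1 : addOrderOf (toJacobian O P) ∣ m0 n d := by
    rw [addOrderOf_dvd_iff_nsmul_eq_zero, nsmul_toJacobian_eq_zero_iff]
    exact ⟨_, E.y_sub_ne_zero w, hw.ord_eq hO hP⟩
  obtain ⟨c, hc⟩ := h1
  have hm := lt_m0 E
  have hm' := m0_lt E
  have hlt := E.lt
  have hpos : 0 < addOrderOf (toJacobian O P) := by
    rw [Nat.pos_iff_ne_zero]; intro h; rw [h] at hc; omega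
  have h2 : n ≤ addOrderOf (toJacobian O P) := by
    by_contra h
    exact nsmul_toJacobian_ne_zero hO hP hw.b_ne_zero hpos (not_le.1 h)
      (addOrderOf_nsmul_eq_zero _)
  have hc1 : c < 2 := by
    by_contra h
    have := Nat.mul_le_mul h2 (not_lt.1 h)
    omega
  interval_cases c <;> omega

theorem nsmul_toJacobian_eq_zero_of_forall {O P : E.Point}
    {u : K[X]} {a : K} (hu : u = C u.leadingCoeff * (X - C a) ^ u.natDegree)
    (hu0 : u ≠ 0) (hu1 : u.natDegree ≠ 0)
    (hg : ∀ Q : E.Point, ((d * u.natDegree : ℕ) : ℤ) * ((Finsupp.single P 1 : E.Point →₀ ℤ) Q -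
      (Finsupp.single O 1 : E.Point →₀ ℤ) Q) = Q.ord (algebraMap K[X] E.FunctionField u)) :
    d • toJacobian O P = 0 := by
  rw [nsmul_toJacobian_eq_zero_iff]
  have hne : algebraMap K[X] E.FunctionField (X - C a) ≠ 0 := by
    rw [map_ne_zero_iff _ E.algebraMap_injective]; exact X_sub_C_ne_zero a
  refine ⟨algebraMap K[X] E.FunctionField (X - C a), hne, fun Q => ?_⟩
  have h := hg Q
  have hlc := leadingCoeff_ne_zero.2 hu0
  conv_rhs at h => rw [hu]
  rw [map_mul, map_pow, algebraMap_C, Q.ord_mul ((_root_.map_ne_zero _).2 hlc) (pow_ne_zero _ hne),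
    Q.ord_algebraMap hlc, zero_add, Q.ord_pow] at h
  refine mul_left_cancel₀ (Nat.cast_ne_zero.2 hu1 : (u.natDegree : ℤ) ≠ 0) ?_
  rw [← h]; push_cast; ring

theorem exists_isTangentForm {O P : E.Point} (hO : E.IsInfinity O) {a b : K}
    (hP : E.IsAffinePoint P a b) (h : addOrderOf (toJacobian O P) = m0 n d) :
    ∃ w : K[X], IsTangentForm n d E.poly a b w := by
  have hm := lt_m0 E
  have hm' := m0_lt E
  have hlt := E.lt
  have hd := E.two_le
  obtain ⟨g, hg0, hg⟩ := nsmul_toJacobian_eq_zero_iff.1 (h ▸ addOrderOf_nsmul_eq_zero _)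
  obtain ⟨p, hp0, -, hpg, hpr⟩ := exists_aeval_y_eq_of_divisor hO (hP.ne hO) hg0 hg
  have hQ (Q : E.Point) := eq_of_vanishes_of_divisor hg0 hg (Q := Q)
  -- A term with `y^j`, `j ≥ 2`, has a pole of order at least `2n > m₀`; likewise a term `x y` would
  -- need `n + d > m₀`.
  have hcoeff (j : ℕ) (hj : 2 ≤ j) : p.coeff j = 0 := by
    by_contra h
    have h1 := E.le_poleOrder h
    have h2 := Nat.mul_le_mul_left n hj
    omega
  obtain ⟨c, hc⟩ : ∃ c, p.coeff 1 = C c := by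
    by_cases h : p.coeff 1 = 0
    · exact ⟨0, by simpa using h⟩
    · have h1 := E.le_poleOrder h
      refine ⟨_, eq_C_of_natDegree_eq_zero ?_⟩
      by_contra h2
      have := Nat.le_mul_of_pos_right d (Nat.pos_of_ne_zero h2)
      omega
  set u := p.coeff 0 with hu
  have hp : p = C u + C (C c) * X := by
    ext1 j
    match j with
    | 0 => simp [hu]
    | 1 => simp [hc]
    | j + 2 => rw [hcoeff _ (by omega)]; simp
  -- Without `y`, the function is a constant times a power of `x - a`, and the order of `P` would
  -- divide `d < m₀`.
  by_cases hc0 : c = 0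
  · rw [hc0, C_0, C_0, zero_mul, add_zero] at hp
    rw [hp, aeval_C] at hpg
    rw [hp, poleOrder_C] at hpr
    have hu1 : u.natDegree ≠ 0 := by
      intro h; rw [h] at hpr; omega
    have hu0 : u ≠ 0 := by rintro h; simp [h] at hu1
    have hroot := (eq_zero_of_forall_vanishes hP hu1 (by rw [hpg]; exact hQ)).2
    have h1 := nsmul_toJacobian_eq_zero_of_forall (eq_C_mul_X_sub_C_pow hroot) hu0 hu1
      (by rw [hpr, hpg]; exact hg)
    have := Nat.le_of_dvd (by omega) (addOrderOf_dvd_iff_nsmul_eq_zero.2 h1)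
    omega
  · set w := C (-c⁻¹) * u with hw
    have hcF : algebraMap K E.FunctionField c ≠ 0 := (_root_.map_ne_zero _).2 hc0
    have hgw : g = algebraMap K E.FunctionField c * (E.y - algebraMap K[X] E.FunctionField w) := by
      rw [← hpg, hp, hw, map_mul, algebraMap_C, map_add, aeval_C, map_mul, aeval_C, aeval_X,
        algebraMap_C, map_neg, map_inv₀]
      field_simp
      ring
    have hne := E.y_sub_ne_zero w
    have hord (Q : E.Point) : Q.ord g = Q.ord (E.y - algebraMap K[X] E.FunctionField w) := by
      rw [hgw, Q.ord_mul hcF hne, Q.ord_algebraMap hc0, zero_add]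
    have hvan (Q : E.Point) (h : Q.Vanishes (E.y - algebraMap K[X] E.FunctionField w)) : Q = P := by
      refine hQ Q ?_
      rwa [← Q.ord_pos_iff hg0, hord, Q.ord_pos_iff hne]
    have hdeg : d * w.natDegree = m0 n d := by
      have h1 := hg O
      rw [hord, hO.ord_y_sub, Finsupp.single_eq_of_ne (hP.ne hO).symm, Finsupp.single_eq_same]
        at h1
      have h2 : (m0 n d : ℤ) = max (n : ℤ) (d * w.natDegree) := by linarith
      rcases max_choice (n : ℤ) (d * w.natDegree) with h3 | h3
      · omega
      · rw [h3] at h2; exact_mod_cast h2.symm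
    have hpol (e : K) (a' : K) : (X - C w : K[X][X]).evalEval a' e = e - w.eval a' := by
      simp [evalEval]
    have hyw : E.y - algebraMap K[X] E.FunctionField w = aeval E.y (X - C w) := by simp
    have hwb : w.eval a = b := by
      have h1 : P.Vanishes (aeval E.y (X - C w)) := by
        rw [← hyw, ← P.ord_pos_iff hne, ← hord, ← hg P, Finsupp.single_eq_same,
          Finsupp.single_eq_of_ne (hP.ne hO)]
        omega
      rw [hP.aeval_y_vanishes_iff, hpol, sub_eq_zero] at h1
      exact h1.symm
    refine ⟨w, Nat.eq_of_mul_eq_mul_left (by omega) hdeg, hwb, ?_⟩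
    have hlt' : E.poly.natDegree < (w ^ d).natDegree := by
      rw [natDegree_pow, hdeg, E.natDegree_poly]; exact hm
    -- A root `e` of `w^d - f` gives a point `(e, w(e))` where `y - w` vanishes; this point is `P`,
    -- so `e = a`.
    have h1 := eq_C_mul_X_sub_C_pow (u := w ^ d - E.poly) (a := a) fun e he => by
      obtain ⟨Q, hQ⟩ := E.exists_isAffinePoint (a := e) (b := w.eval e) (by
        simpa [sub_eq_zero] using he)
      have h2 := hvan Q (by
        rw [hyw, hQ.aeval_y_vanishes_iff, hpol, sub_self])
      rw [h2] at hQ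
      exact (hQ.coord_eq hP).1
    rw [natDegree_sub_eq_left_of_natDegree_lt hlt',
      leadingCoeff_sub_of_degree_lt (degree_lt_degree hlt'), leadingCoeff_pow, natDegree_pow, hdeg] at h1
    rw [← h1, sub_sub_cancel]

end Curve

/-! ### Descent from `K` to the base field. -/

theorem mem_nonunits_comap_iff {F F' : Type*} [Field F] [Field F'] (φ : F →+* F')
    (V : ValuationSubring F') (g : F) : g ∈ (V.comap φ).nonunits ↔ φ g ∈ V.nonunits := by
  rw [ValuationSubring.mem_nonunits_iff_or, ValuationSubring.mem_nonunits_iff_or,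
    ValuationSubring.mem_comap, map_inv₀, map_eq_zero_iff φ φ.injective]

/-- The coefficients of an approximate `d`-th root are rational over the base field. -/
theorem coeff_mem_range_of_X_pow_dvd {k K : Type*} [Field k] [Field K] (α : k →+* K) {d m : ℕ}
    (hd : (d : K) ≠ 0) {f : k[X]} {w : K[X]} {b : k} (hb : b ≠ 0) (hw : w.eval 0 = α b)
    (h : X ^ m ∣ w ^ d - f.map α) (i : ℕ) (hi : i < m) : w.coeff i ∈ α.fieldRange := by
  induction i using Nat.strong_induction_on with
  | _ i ih =>
  rw [← coeff_zero_eq_eval_zero] at hw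
  by_cases hi0 : i = 0
  · rw [hi0, hw]; exact ⟨b, rfl⟩
  -- The truncation `t` of `w` below degree `i` is rational by induction.
  set t : K[X] := ∑ j ∈ Finset.range i, C (w.coeff j) * X ^ j with ht
  have htc (j : ℕ) : t.coeff j = if j < i then w.coeff j else 0 := by
    simp [ht, coeff_X_pow]
  obtain ⟨r, hr⟩ : X ^ i ∣ w - t := by
    rw [X_pow_dvd_iff]
    intro j hj
    simp [htc, hj]
  have hlift : t ∈ lifts α := by
    rw [lifts_iff_coeff_lifts]
    intro j
    rw [htc]
    split_ifs with hj
    · exact ih j hj (hj.trans hi)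
    · exact ⟨0, map_zero _⟩
  obtain ⟨c, hc⟩ := (lifts_iff_coeff_lifts _).1 (pow_mem hlift d) i
  -- Comparing coefficients of `x^i` in `w^d = t^d + d t^(d-1) (w - t) + …` gives `f_i = c + d
  -- b^(d-1) w_i`, which is solved for `w_i`.
  obtain ⟨q, hq⟩ := powAddExpansion t (w - t) d
  rw [add_sub_cancel, hr] at hq
  have hr0 : r.coeff 0 = w.coeff i := by
    have := congrArg (coeff · i) hr
    simpa [htc, coeff_X_pow_mul'] using this.symm
  have h1 : (w ^ d).coeff i = α (f.coeff i) := by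
    have := X_pow_dvd_iff.1 h i hi
    rwa [coeff_sub, coeff_map, sub_eq_zero] at this
  have h2 : ((d : K[X]) * t ^ (d - 1) * (X ^ i * r)).coeff i = d * α b ^ (d - 1) * w.coeff i := by
    rw [show ((d : K[X]) * t ^ (d - 1) * (X ^ i * r)) = X ^ i * (C (d : K) * (t ^ (d - 1) * r)) by
      rw [C_eq_natCast]; ring, coeff_X_pow_mul', if_pos le_rfl, Nat.sub_self, coeff_C_mul, mul_coeff_zero,
      coeff_zero_eq_eval_zero (t ^ (d - 1)), eval_pow, ← coeff_zero_eq_eval_zero, htc,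
      if_pos (Nat.pos_of_ne_zero hi0), hw, hr0]
    ring
  have h3 : (q * (X ^ i * r) ^ 2).coeff i = 0 := by
    rw [show q * (X ^ i * r) ^ 2 = X ^ (i + i) * (q * r ^ 2) by ring, coeff_X_pow_mul', if_neg (by omega)]
  have h4 := congrArg (coeff · i) hq
  simp only [coeff_add] at h4
  rw [h1, h2, h3, ← hc, add_zero] at h4
  have hne : (d : K) * α b ^ (d - 1) ≠ 0 :=
    mul_ne_zero hd (pow_ne_zero _ ((_root_.map_ne_zero _).2 hb))
  have h5 : w.coeff i = α ((f.coeff i - c) / (d * b ^ (d - 1))) := by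
    rw [map_div₀, map_sub, map_mul, map_pow, map_natCast, eq_div_iff hne, h4]
    ring
  exact ⟨_, h5.symm⟩

/-- After translating `a` to `0`, the coefficients below `m` are rational and the others vanish
because `deg w < m`. -/
theorem exists_map_eq_of_X_sub_C_pow_dvd {k K : Type*} [Field k] [Field K] (α : k →+* K) {d m : ℕ}
    (hd : (d : K) ≠ 0) {f : k[X]} {w : K[X]} {a b : k} (hb : b ≠ 0) (hw : w.eval (α a) = α b)
    (h : (X - C (α a)) ^ m ∣ w ^ d - f.map α) (hm : w.natDegree < m) :
    ∃ u : k[X], u.map α = w := by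
  have h1 : w.comp (X + C (α a)) ∈ lifts α := by
    rw [lifts_iff_coeff_lifts]
    intro i
    by_cases hi : i < m
    · refine coeff_mem_range_of_X_pow_dvd α hd (f := f.comp (X + C a)) hb (by simpa using hw)
        (m := m) ?_ i hi
      have := map_dvd (compRingHom (X + C (α a))) h
      simpa [map_comp] using this
    · refine ⟨0, ?_⟩
      rw [map_zero, coeff_eq_zero_of_natDegree_lt]
      rw [natDegree_comp, natDegree_X_add_C, mul_one]
      omega
  obtain ⟨u, hu⟩ := (mem_lifts _).1 h1
  refine ⟨u.comp (X - C a), ?_⟩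
  rw [map_comp, hu, comp_assoc]
  simp

namespace Curve

variable {k : Type*} [Field k] {n d : ℕ} (E : Curve k n d) (K : Type*) [Field K] [Algebra k K]

theorem functionFieldMap_y : E.functionFieldMap K E.y = (E.baseChange K).y :=
  AdjoinRoot.map_root _ _ _ _

theorem functionFieldMap_algebraMap (u : k[X]) :
    E.functionFieldMap K (algebraMap k[X] E.FunctionField u) =
      algebraMap K[X] (E.baseChange K).FunctionField (u.map (algebraMap k K)) := by
  rw [IsScalarTower.algebraMap_apply k[X] (RatFunc k) E.FunctionField,
    IsScalarTower.algebraMap_apply K[X] (RatFunc K) (E.baseChange K).FunctionField,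
    ← ratFuncMap_algebraMap]
  exact AdjoinRoot.map_of _ _ _ _ _

theorem functionFieldMap_x : E.functionFieldMap K E.x = (E.baseChange K).x := by
  rw [← algebraMap_X, functionFieldMap_algebraMap, Polynomial.map_X, algebraMap_X]

theorem functionFieldMap_algebraMap_base (c : k) :
    E.functionFieldMap K (algebraMap k E.FunctionField c) =
      algebraMap K (E.baseChange K).FunctionField (algebraMap k K c) := by
  rw [← algebraMap_C, functionFieldMap_algebraMap, Polynomial.map_C, algebraMap_C]

variable {E K}

theorem isTangentForm_map_iff {f : k[X]} {a b : k} {w : k[X]} :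
    IsTangentForm n d (f.map (algebraMap k K)) (algebraMap k K a) (algebraMap k K b)
      (w.map (algebraMap k K)) ↔ IsTangentForm n d f a b w := by
  have hinj := map_injective _ (algebraMap k K).injective
  rw [IsTangentForm, IsTangentForm, natDegree_map, leadingCoeff_map, eval_map_algebraMap,
    aeval_algebraMap_apply, (algebraMap k K).injective.eq_iff, ← hinj.eq_iff (a := f)]
  simp

theorem mapsTo_affine {P : E.Point} {PK : (E.baseChange K).Point} {a b : k}
    (hP : E.IsAffinePoint P a b)
    (hPK : (E.baseChange K).IsAffinePoint PK (algebraMap k K a) (algebraMap k K b)) :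
    PK.MapsTo (E.functionFieldMap K) P := by
  refine (hP.ring_eq (V := PK.ring.comap (E.functionFieldMap K)) (fun c => ?_) ?_ ?_).symm
  · rw [ValuationSubring.mem_comap, functionFieldMap_algebraMap_base]
    exact PK.algebraMap_mem _
  · rw [mem_nonunits_comap_iff, map_sub, functionFieldMap_algebraMap_base, functionFieldMap_x]
    exact hPK.1
  · rw [mem_nonunits_comap_iff, map_sub, functionFieldMap_algebraMap_base, functionFieldMap_y]
    exact hPK.2

theorem IsAffinePoint.of_mapsTo {P : E.Point} {PK : (E.baseChange K).Point}
    (h : PK.MapsTo (E.functionFieldMap K) P) {a b : k} (hP : E.IsAffinePoint P a b) :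
    (E.baseChange K).IsAffinePoint PK (algebraMap k K a) (algebraMap k K b) := by
  obtain ⟨h1, h2⟩ := hP
  rw [Place.HasValue, Place.Vanishes, h, mem_nonunits_comap_iff, map_sub,
    functionFieldMap_algebraMap_base] at h1 h2
  rw [functionFieldMap_x] at h1
  rw [functionFieldMap_y] at h2
  exact ⟨h1, h2⟩

theorem exists_isAffinePoint_of_x_mem (P : E.RationalPoint) (hx : E.x ∈ P.1.ring) :
    ∃ a b, E.IsAffinePoint P.1 a b := by
  obtain ⟨a, ha⟩ := P.2 _ hx
  have hy : E.y ∈ P.1.ring := by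
    have := E.aeval_y_mem P.1.algebraMap_mem hx X
    rwa [aeval_X] at this
  obtain ⟨b, hb⟩ := P.2 _ hy
  exact ⟨a, b, ha, hb⟩

theorem hasOrder_m0_iff [IsAlgClosed K] (P : E.RationalPoint) : E.HasOrder K P (m0 n d) ↔
    ∃ a b w, E.IsAffinePoint P.1 a b ∧ IsTangentForm n d E.poly a b w := by
  have hm := lt_m0 E
  have hm' := m0_lt E
  have hd := E.two_le
  have hlt := E.lt
  constructor
  · rintro ⟨O, PK, hO, hPK, -, hord⟩
    -- The point at infinity has order `1 < m₀`.
    have hne : PK ≠ O := by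
      rintro rfl
      have h0 : toJacobian PK PK = 0 := by
        simp only [toJacobian, sub_self]
        exact QuotientAddGroup.mk_zero _
      rw [h0, addOrderOf_zero] at hord
      omega
    have hx : (E.baseChange K).x ∈ PK.ring := by
      by_contra h
      exact hne (IsInfinity.eq h hO)
    obtain ⟨a, b, hP⟩ := exists_isAffinePoint_of_x_mem P (by
      rw [hPK, ValuationSubring.mem_comap, functionFieldMap_x]; exact hx)
    obtain ⟨w, hw⟩ := exists_isTangentForm hO (hP.of_mapsTo hPK) hord
    obtain ⟨u, rfl⟩ := exists_map_eq_of_X_sub_C_pow_dvd (algebraMap k K) (w := w) (f := E.poly)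
      (d := d) (m := m0 n d) (E.baseChange K).cast_ne_zero
      ((_root_.map_ne_zero (algebraMap k K)).1 hw.b_ne_zero) hw.2.1 (by
        have h1 : E.poly.map (algebraMap k K) = _ := hw.2.2
        rw [h1, sub_sub_cancel]
        exact dvd_mul_left _ _) (by
        rw [hw.1, m0]
        have : 0 < ell0 n d := Nat.div_pos (by omega) (by omega)
        exact lt_mul_of_one_lt_left this (by omega))
    exact ⟨a, b, u, hP, isTangentForm_map_iff.1 hw⟩
  · rintro ⟨a, b, w, hP, hw⟩
    obtain ⟨O, hO⟩ := (E.baseChange K).exists_isInfinity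
    obtain ⟨PK, hPK⟩ := (E.baseChange K).exists_isAffinePoint (a := algebraMap k K a)
      (b := algebraMap k K b) (by
        have : (E.baseChange K).poly = E.poly.map (algebraMap k K) := rfl
        rw [this, eval_map_algebraMap, aeval_algebraMap_apply, ← map_pow, hP.pow_eq]
        rfl)
    have hw' : IsTangentForm n d (E.baseChange K).poly _ _ _ := isTangentForm_map_iff.2 hw
    exact ⟨O, PK, hO, mapsTo_affine hP hPK, by omega, hw'.addOrderOf_eq hO hPK⟩

end Curve

/-! ### Affine substitutions and the normal form. -/

namespace Curve

variable {k : Type*} [Field k] {n d : ℕ} {E E' : Curve k n d}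

/-- The new leading coefficient is `γ⁻¹ B α^ℓ₀`; its `d`-th power absorbs the factor `α^m₀` coming
from `(x - a)^m₀`. -/
theorem isTangentForm_comp {f f' : k[X]} {a b a' b' α β γ : k} {w : k[X]} (hα : α ≠ 0)
    (hγ : γ ≠ 0) (h : IsTangentForm n d f a b w) (hf : C (γ ^ d) * f' = f.comp (C α * X + C β))
    (ha : α * a' + β = a) (hb : γ * b' = b) :
    IsTangentForm n d f' a' b' (C γ⁻¹ * w.comp (C α * X + C β)) := by
  have hdeg : (C α * X + C β).natDegree = 1 := natDegree_linear hα
  have hγ' := inv_ne_zero hγ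
  obtain ⟨h1, h2, h3⟩ := h
  refine ⟨?_, ?_, ?_⟩
  · rw [natDegree_C_mul hγ', natDegree_comp, hdeg, mul_one, h1]
  · simp only [eval_mul, eval_C, eval_comp, eval_add, eval_X]
    rw [ha, h2, ← hb, inv_mul_cancel_left₀ hγ]
  · have hlc : (C γ⁻¹ * w.comp (C α * X + C β)).leadingCoeff ^ d =
        γ⁻¹ ^ d * (w.leadingCoeff ^ d * α ^ m0 n d) := by
      rw [leadingCoeff_mul, leadingCoeff_C, leadingCoeff_comp (by rw [hdeg]; exact one_ne_zero),
        leadingCoeff_linear hα, h1, mul_pow, mul_pow, ← pow_mul, m0, mul_comm d]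
    have hX : C α * X + C β - C a = C α * (X - C a') := by
      rw [← ha]; simp only [map_add, map_mul]; ring
    have hγd : C (γ⁻¹ ^ d) * C (γ ^ d) = 1 := by
      rw [← C_mul, ← mul_pow, inv_mul_cancel₀ hγ, one_pow, C_1]
    have hf' : f' = C (γ⁻¹ ^ d) * f.comp (C α * X + C β) := by
      rw [← hf, ← mul_assoc, hγd, one_mul]
    rw [hlc, hf', h3]
    simp only [sub_comp, pow_comp, mul_comp, C_comp, X_comp]
    rw [hX]
    simp only [map_mul, map_pow, mul_pow]
    ring

/-- The degree of `q` is automatic. With `v = B x^ℓ₀`, one has `f = w^d - v^d = S q`, where the `d`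
summands of `S` all have degree `ℓ₀(d - 1)` and leading coefficient `B^(d-1)`. As `d ≠ 0` in `k`,
`deg S = ℓ₀(d - 1)`. -/
theorem isNormalForm_iff (E : Curve k n d) :
    IsNormalForm n d E.poly ↔ ∃ w, IsTangentForm n d E.poly 0 1 w := by
  constructor
  · rintro ⟨B, w, q, -, hw1, rfl, hw3, hf, -⟩
    refine ⟨w, hw1, hw3, ?_⟩
    rw [hf, C_0, sub_zero]; ring
  · rintro ⟨w, hw⟩
    have hw' := hw
    obtain ⟨h1, h2, h3⟩ := hw
    have hl : 0 < ell0 n d := by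
      have := E.two_le; have := E.lt
      exact Nat.div_pos (by omega) (by omega)
    have hB : w.leadingCoeff ≠ 0 := leadingCoeff_ne_zero.2 hw'.ne_zero
    set B := w.leadingCoeff with hBdef
    set q := w - C B * X ^ ell0 n d with hq
    have hwq : w = C B * X ^ ell0 n d + q := by rw [hq]; ring
    set v := C B * X ^ ell0 n d with hv
    have hvd : v.natDegree = ell0 n d := natDegree_C_mul_X_pow _ _ hB
    have hvl : v.leadingCoeff = B := by rw [hv, leadingCoeff_mul_X_pow, leadingCoeff_C]
    have hpow : C (B ^ d) * X ^ m0 n d = v ^ d := by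
      rw [hv, mul_pow, ← pow_mul, mul_comm (ell0 n d), m0, C_pow]
    rw [C_0, sub_zero, hpow] at h3
    have hS := (Commute.all w v).geom_sum₂_mul d
    set S := ∑ i ∈ Finset.range d, w ^ i * v ^ (d - 1 - i) with hSdef
    rw [← h3] at hS
    have hterm (i : ℕ) (hi : i ∈ Finset.range d) :
        (w ^ i * v ^ (d - 1 - i)).natDegree = ell0 n d * (d - 1) ∧
        (w ^ i * v ^ (d - 1 - i)).leadingCoeff = B ^ (d - 1) := by
      have hid : i + (d - 1 - i) = d - 1 := by have := Finset.mem_range.1 hi; omega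
      have hv0 : v ≠ 0 := by rintro h; rw [h] at hvl; exact hB (by rw [← hvl]; simp)
      constructor
      · rw [natDegree_mul (pow_ne_zero _ hw'.ne_zero) (pow_ne_zero _ hv0), natDegree_pow,
          natDegree_pow, h1, hvd, ← add_mul, hid, mul_comm]
      · rw [leadingCoeff_mul, leadingCoeff_pow, leadingCoeff_pow, hvl, ← hBdef, ← pow_add, hid]
    have hScoeff : S.coeff (ell0 n d * (d - 1)) ≠ 0 := by
      rw [hSdef, finsetSum_coeff, Finset.sum_congr rfl (fun i hi => by
        rw [← (hterm i hi).1, coeff_natDegree, (hterm i hi).2]), Finset.sum_const,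
        Finset.card_range, nsmul_eq_mul]
      exact mul_ne_zero E.cast_ne_zero (pow_ne_zero _ hB)
    have hSdeg : S.natDegree = ell0 n d * (d - 1) :=
      le_antisymm (natDegree_sum_le_of_forall_le _ _ fun i hi => (hterm i hi).1.le)
        (le_natDegree_of_ne_zero hScoeff)
    have hq0 : q ≠ 0 := by
      intro h; apply E.poly_ne_zero
      rw [← hS, ← hq, h, mul_zero]
    have hS0 : S ≠ 0 := by rintro h; simp [h] at hScoeff
    have hdeg : ell0 n d * (d - 1) + q.natDegree = n := by
      have := natDegree_mul hS0 hq0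
      rw [hq, hS, E.natDegree_poly, hSdeg] at this
      exact this.symm
    refine ⟨B, w, q, hB, h1, rfl, h2, ?_, hq0, ?_, ?_, hwq⟩
    · rw [neg_mul, hpow]; rw [h3]; ring
    · have hd := E.two_le
      zify [(by omega : 1 ≤ d)] at hdeg
      rw [m0]
      push_cast
      linarith
    · rw [hq, hv]
      simp [h2, hl.ne']

theorem surjective_of_algHom (φ : E'.FunctionField →ₐ[k] E.FunctionField)
    (hx : E.x ∈ φ.fieldRange) (hy : E.y ∈ φ.fieldRange) : Function.Surjective φ := by
  have h1 (p : k[X][X]) : aeval E.y p ∈ φ.fieldRange := by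
    rw [aeval_eq_sum_range]
    refine sum_mem fun i _ => ?_
    rw [Algebra.smul_def, ← aeval_x]
    refine mul_mem ?_ (pow_mem hy _)
    rw [aeval_eq_sum_range]
    exact sum_mem fun i _ => φ.fieldRange.smul_mem (pow_mem hx _)
  intro g
  by_cases hg : g = 0
  · exact ⟨0, by simp [hg]⟩
  · obtain ⟨p, q, -, -, -, -, rfl⟩ := E.exists_eq_div g hg
    exact div_mem (h1 p) (h1 q)

theorem exists_iso {α β γ : k} (hα : α ≠ 0) (hγ : γ ≠ 0)
    (h : C (γ ^ d) * E.poly = E'.poly.comp (C α * X + C β)) :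
    ∃ ψ : Iso E E', ψ.pullback E'.x = algebraMap k[X] E.FunctionField (C α * X + C β) ∧
      ψ.pullback E'.y = algebraMap k E.FunctionField γ * E.y := by
  have hφ (u : k[X]) : aeval (algebraMap k[X] E.FunctionField (C α * X + C β)) u =
      algebraMap k[X] E.FunctionField (u.comp (C α * X + C β)) := by
    rw [aeval_algebraMap_apply, comp_eq_aeval]
  have hinj : Function.Injective
      (aeval (R := k) (algebraMap k[X] E.FunctionField (C α * X + C β))) := by
    rw [injective_iff_map_eq_zero]
    intro u hu
    rw [hφ, map_eq_zero_iff _ E.algebraMap_injective, comp_eq_zero_iff] at hu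
    refine hu.resolve_right fun h => ?_
    have := natDegree_linear hα (b := β)
    rw [h.2, natDegree_C] at this
    exact zero_ne_one this
  let i : RatFunc k →ₐ[k] E.FunctionField :=
    RatFunc.liftAlgHom (aeval (algebraMap k[X] E.FunctionField (C α * X + C β)))
      (nonZeroDivisors_le_comap_nonZeroDivisors_of_injective _ hinj)
  have hi (u : k[X]) : i (algebraMap k[X] (RatFunc k) u) =
      algebraMap k[X] E.FunctionField (u.comp (C α * X + C β)) := by
    rw [← hφ]
    have := RatFunc.liftAlgHom_apply_div (aeval (algebraMap k[X] E.FunctionField (C α * X + C β)))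
      (nonZeroDivisors_le_comap_nonZeroDivisors_of_injective _ hinj) u 1
    rw [map_one, div_one, map_one, div_one] at this
    exact this
  let φ : E'.FunctionField →ₐ[k] E.FunctionField :=
    AdjoinRoot.liftAlgHom E'.equation i (algebraMap k E.FunctionField γ * E.y) (by
      rw [show E'.equation = X ^ d - C (algebraMap k[X] (RatFunc k) E'.poly) from rfl, eval₂_sub, eval₂_X_pow, eval₂_C, mul_pow, y_pow]
      change _ - i _ = 0
      rw [hi, ← h, map_mul, algebraMap_C, map_pow, sub_self])
  have hx : φ E'.x = algebraMap k[X] E.FunctionField (C α * X + C β) := by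
    rw [x, ← RatFunc.algebraMap_X]
    exact (AdjoinRoot.liftAlgHom_of _ _ _ _ _).trans (by rw [hi, X_comp])
  have hy : φ E'.y = algebraMap k E.FunctionField γ * E.y := AdjoinRoot.liftAlgHom_root _ _ _ _
  have hsurj : Function.Surjective φ := by
    refine surjective_of_algHom φ ⟨algebraMap k _ α⁻¹ * (E'.x - algebraMap k _ β), ?_⟩
      ⟨algebraMap k _ γ⁻¹ * E'.y, ?_⟩
    · have : (φ : E'.FunctionField →+* E.FunctionField) E'.x = φ E'.x := rfl
      simp only [AlgHom.toRingHom_eq_coe, map_mul, map_sub, this, hx, RingHom.coe_coe, AlgHom.commutes]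
      rw [← algebraMap_C, ← algebraMap_C, ← map_sub, ← map_mul, add_sub_cancel_right, ← mul_assoc,
        ← C_mul, inv_mul_cancel₀ hα, C_1, one_mul, algebraMap_X]
    · simp only [AlgHom.toRingHom_eq_coe, map_mul, RingHom.coe_coe, AlgHom.commutes, hy]
      rw [← mul_assoc, ← map_mul, inv_mul_cancel₀ hγ, map_one, one_mul]
  exact ⟨⟨AlgEquiv.ofBijective φ ⟨φ.toRingHom.injective, hsurj⟩⟩, hx, hy⟩

theorem Iso.preservesInfinity {ψ : Iso E E'} {α β : k} (hα : α ≠ 0)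
    (h : ψ.pullback E'.x = algebraMap k[X] E.FunctionField (C α * X + C β)) :
    ψ.PreservesInfinity := by
  obtain ⟨O, hO⟩ := E.exists_isInfinity
  have hk (c : k) : algebraMap k E'.FunctionField c ∈
      O.ring.comap (ψ.pullback : E'.FunctionField →+* E.FunctionField) := by
    rw [ValuationSubring.mem_comap]
    have := O.algebraMap_mem c
    rwa [← ψ.pullback.commutes] at this
  have hx : E'.x ∉ O.ring.comap (ψ.pullback : E'.FunctionField →+* E.FunctionField) := by
    rw [ValuationSubring.mem_comap]
    change ψ.pullback E'.x ∉ O.ring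
    intro h'
    apply hO
    rw [h, map_add, map_mul, algebraMap_C, algebraMap_C, algebraMap_X] at h'
    have h1 := mul_mem (O.algebraMap_mem α⁻¹) (sub_mem h' (O.algebraMap_mem β))
    rwa [add_sub_cancel_right, ← mul_assoc, ← map_mul, inv_mul_cancel₀ hα, map_one, one_mul] at h1
  exact ⟨O, ⟨_, hk, E'.isDiscreteValuationRing_of_x_notMem hk hx⟩, hO, hx, rfl⟩

end Curve

/-! ### Isomorphisms that preserve infinity. -/

namespace Curve

variable {k : Type*} [Field k] {n d : ℕ} {E E' : Curve k n d}

theorem Iso.pullback_algebraMap (ψ : Iso E E') {u : k[X]}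
    (h : ψ.pullback E'.x = algebraMap k[X] E.FunctionField u) (v : k[X]) :
    ψ.pullback (algebraMap k[X] E'.FunctionField v) =
      algebraMap k[X] E.FunctionField (v.comp u) := by
  rw [← aeval_x, ← aeval_algHom_apply ψ.pullback, h, aeval_algebraMap_apply, comp_eq_aeval]

/-- After division by `γ`, the relation is a monic polynomial `(Y + r)^d - h'` divisible by `Y^d -
f`, hence equal to it. The coefficient `d r` of `Y^(d-1)` must vanish. -/
theorem eq_of_linear_pow_eq (E : Curve k n d) {h u : k[X]} {γ : k} (hγ : γ ≠ 0)
    (heq : (algebraMap k E.FunctionField γ * E.y + algebraMap k[X] E.FunctionField u) ^ d =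
      algebraMap k[X] E.FunctionField h) : u = 0 ∧ C (γ ^ d) * E.poly = h := by
  have hd := E.two_le
  have hγ' : C γ * C γ⁻¹ = (1 : k[X]) := by rw [← C_mul, mul_inv_cancel₀ hγ, C_1]
  set r := C γ⁻¹ * u with hr
  set h' := C γ⁻¹ ^ d * h with hh'
  have hu : u = C γ * r := by rw [hr, ← mul_assoc, hγ', one_mul]
  have hh : h = C γ ^ d * h' := by rw [hh', ← mul_assoc, ← mul_pow, hγ', one_pow, one_mul]
  have hzero : aeval E.y ((X + C r) ^ d - C h') = 0 := by
    have hγF : (algebraMap k E.FunctionField γ) ^ d ≠ 0 :=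
      pow_ne_zero _ ((_root_.map_ne_zero _).2 hγ)
    refine (mul_eq_zero_iff_left hγF).1 ?_
    rw [hh, hu, map_mul _ (C γ) r, map_mul _ (C γ ^ d) h', map_pow, algebraMap_C, ← mul_add, mul_pow] at heq
    rw [map_sub, map_pow, map_add, aeval_X, aeval_C, aeval_C, mul_sub, heq, sub_self]
  rw [aeval_y_eq_zero_iff] at hzero
  have hmonic : ((X + C r) ^ d : k[X][X]).Monic := (monic_X_add_C r).pow d
  have hdeg : ((X + C r) ^ d : k[X][X]).natDegree = d := by
    rw [natDegree_pow, natDegree_X_add_C, mul_one]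
  have hmonic' : ((X + C r) ^ d - C h').Monic := by
    refine hmonic.sub_of_left (degree_C_le.trans_lt ?_)
    rw [degree_eq_natDegree hmonic.ne_zero, hdeg]
    exact_mod_cast (by omega : 0 < d)
  have key : E.affineEquation = (X + C r) ^ d - C h' :=
    eq_of_dvd_of_natDegree_le_of_leadingCoeff hzero
      (by rw [natDegree_sub_C, hdeg, natDegree_affineEquation])
      (by rw [hmonic'.leadingCoeff, E.affineEquation_monic.leadingCoeff])
  have hr0 : r = 0 := by
    have h1 := congrArg (coeff · (d - 1)) key
    simp only [affineEquation, coeff_sub, coeff_X_pow, coeff_C, if_neg (by omega : ¬ d - 1 = d),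
      if_neg (by omega : ¬ d - 1 = 0), coeff_X_add_C_pow, sub_zero,
      (by omega : d - (d - 1) = 1), pow_one, Nat.choose_symm (by omega : 1 ≤ d), Nat.choose_one_right]
      at h1
    refine (mul_eq_zero.1 h1.symm).resolve_right ?_
    rw [← C_eq_natCast]
    exact C_ne_zero.2 E.cast_ne_zero
  refine ⟨by rw [hu, hr0, mul_zero], ?_⟩
  rw [hr0, C_0, add_zero, affineEquation, sub_right_inj, C_inj] at key
  rw [hh, key, C_pow]

/-- The pullbacks of `x` and `y` are regular off infinity with poles of order `d` and `n` there, so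
they are `αx + β` and `γy + u(x)`. The curve equation then forces `u = 0`. -/
theorem Iso.exists_eq (ψ : Iso E E') (hψ : ψ.PreservesInfinity) : ∃ α β γ : k, α ≠ 0 ∧ γ ≠ 0 ∧
    ψ.pullback E'.x = algebraMap k[X] E.FunctionField (C α * X + C β) ∧
    ψ.pullback E'.y = algebraMap k E.FunctionField γ * E.y ∧
    C (γ ^ d) * E.poly = E'.poly.comp (C α * X + C β) := by
  obtain ⟨O, O', hO, hO', hOO'⟩ := hψ
  have hd := E.two_le
  have hlt := E.lt
  let φ : E'.FunctionField →+* E.FunctionField := ψ.pullback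
  have hφ (g) : φ g = ψ.pullback g := rfl
  have hk (R : E.Point) (c : k) : algebraMap k E'.FunctionField c ∈ R.ring.comap φ := by
    rw [ValuationSubring.mem_comap, hφ, ψ.pullback.commutes]
    exact R.algebraMap_mem c
  -- A point that maps to infinity has the same pulled-back ring as `O`; as the pullback is
  -- surjective, `x` is not regular there either.
  have hxmem (R : E.Point) (hR : E.x ∈ R.ring) : E'.x ∈ R.ring.comap φ := by
    by_contra hx
    have h1 : (⟨_, hk R, E'.isDiscreteValuationRing_of_x_notMem (hk R) hx⟩ : E'.Point) = O' :=
      IsInfinity.eq (O := ⟨_, hk R, E'.isDiscreteValuationRing_of_x_notMem (hk R) hx⟩) hx hO'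
    have h2 : R.ring.comap φ = O.ring.comap φ := (congrArg Place.ring h1).trans hOO'
    obtain ⟨z, hz⟩ := ψ.pullback.surjective E.x
    have h3 : z ∈ R.ring.comap φ := by
      rw [ValuationSubring.mem_comap, hφ, hz]; exact hR
    rw [h2, ValuationSubring.mem_comap, hφ, hz] at h3
    exact hO h3
  have hymem (R : E.Point) (hR : E.x ∈ R.ring) : E'.y ∈ R.ring.comap φ := by
    have := E'.aeval_y_mem (hk R) (hxmem R hR) X
    rwa [aeval_X] at this
  obtain ⟨p, hpd, hp⟩ := E.exists_aeval_y_eq_of_forall_mem hxmem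
  obtain ⟨q, hqd, hq⟩ := E.exists_aeval_y_eq_of_forall_mem hymem
  rw [hφ] at hp hq
  have hv (c : k) (hc : c ≠ 0) : (O.valuation.comap φ) (algebraMap k E'.FunctionField c) = 1 := by
    rw [Valuation.comap_apply, hφ, ψ.pullback.commutes]
    exact O.valuation_algebraMap hc
  have hx1 : 1 < (O.valuation.comap φ) E'.x := by
    rw [Valuation.comap_apply, ← not_le, O.valuation_le_one_iff, ← ValuationSubring.mem_comap,
      ← hOO']
    exact hO'
  obtain ⟨g, hg0, hg⟩ := O.exists_ord_eq_one
  obtain ⟨z, rfl⟩ := ψ.pullback.surjective g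
  -- Surjectivity of the pullback keeps the pulled-back valuation normalized, so the pole orders are
  -- exactly `d` and `n`.
  have ht := E'.valuation_infParameter_eq_exp_one hv hx1 (g := z) (by
    rw [Valuation.comap_apply, hφ, O.valuation_eq_exp hg0, hg])
  obtain ⟨h1, h2, -⟩ := E'.valuation_infParameter hv hx1
  have hordx : O.ord (ψ.pullback E'.x) = -d := by
    rw [ht, Valuation.comap_apply, hφ] at h1
    rw [Place.ord_eq, ← h1, WithZero.log_pow]; simp
  have hordy : O.ord (ψ.pullback E'.y) = -n := by
    rw [ht, Valuation.comap_apply, hφ] at h2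
    rw [Place.ord_eq, ← h2, WithZero.log_pow]; simp
  have hp0 : p ≠ 0 := by
    rintro rfl
    rw [← hp, map_zero, Place.ord_eq] at hordx
    simp at hordx; omega
  have hq0 : q ≠ 0 := by
    rintro rfl
    rw [← hq, map_zero, Place.ord_eq] at hordy
    simp at hordy; omega
  have hpo : E.poleOrder p = d := by
    rw [← hp, hO.ord_aeval_y hp0 hpd] at hordx; omega
  have hqo : E.poleOrder q = n := by
    rw [← hq, hO.ord_aeval_y hq0 hqd] at hordy; omega
  have hpC : p = C (p.coeff 0) := by
    ext1 j
    rw [coeff_C]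
    split_ifs with h
    · rw [h]
    · by_contra hj
      have h1 := E.le_poleOrder hj
      have h2 : n ≤ n * j := Nat.le_mul_of_pos_right n (Nat.pos_of_ne_zero h)
      omega
  have hu1 : (p.coeff 0).natDegree = 1 := by
    rw [hpC, poleOrder_C] at hpo
    exact Nat.eq_of_mul_eq_mul_left (by omega) (hpo.trans (mul_one d).symm)
  obtain ⟨α, hα, β, hαβ⟩ : ∃ α, α ≠ 0 ∧ ∃ β, p.coeff 0 = C α * X + C β :=
    ⟨_, by
      rw [← hu1]; exact leadingCoeff_ne_zero.2 (by rintro h; simp [h] at hu1), _,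
      eq_X_add_C_of_natDegree_le_one hu1.le⟩
  have hψx : ψ.pullback E'.x = algebraMap k[X] E.FunctionField (C α * X + C β) := by
    rw [← hp, hpC, aeval_C, hαβ]
  obtain ⟨γ, hγ⟩ : ∃ c, q.coeff 1 = C c := by
    by_cases h : q.coeff 1 = 0
    · exact ⟨0, by simpa using h⟩
    · have h1 := E.le_poleOrder h
      refine ⟨_, eq_C_of_natDegree_eq_zero ?_⟩
      by_contra h2
      have := Nat.le_mul_of_pos_right d (Nat.pos_of_ne_zero h2)
      omega
  have hqC : q = C (q.coeff 0) + C (C γ) * X := by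
    ext1 j
    match j with
    | 0 => simp
    | 1 => simp [hγ]
    | j + 2 =>
      have h : q.coeff (j + 2) = 0 := by
        by_contra h
        have h1 := E.le_poleOrder h
        have h2 := Nat.mul_le_mul_left n (by omega : 2 ≤ j + 2)
        omega
      rw [h]; simp
  have hγ0 : γ ≠ 0 := by
    rintro rfl
    rw [C_0, C_0, zero_mul, add_zero] at hqC
    rw [hqC, poleOrder_C] at hqo
    exact E.not_dvd ⟨_, hqo.symm⟩
  have hψy : ψ.pullback E'.y =
      algebraMap k E.FunctionField γ * E.y + algebraMap k[X] E.FunctionField (q.coeff 0) := by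
    rw [← hq]
    conv_lhs => rw [hqC]
    rw [map_add, aeval_C, map_mul, aeval_C, aeval_X, algebraMap_C, add_comm]
  have hpow := congrArg ψ.pullback E'.y_pow
  rw [map_pow, hψy, ψ.pullback_algebraMap hψx] at hpow
  obtain ⟨h3, h4⟩ := eq_of_linear_pow_eq E hγ0 hpow
  rw [h3, map_zero, add_zero] at hψy
  exact ⟨α, β, γ, hα, hγ0, hψx, hψy, h4⟩

end Curve

/-! ### Moving the point to `(0, 1)`. -/

namespace Curve

variable {k : Type*} [Field k] {n d : ℕ} {E E' : Curve k n d}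

theorem Iso.sends_iff_of_isAffinePoint (ψ : Iso E E') {α β γ a b : k} (hα : α ≠ 0) (hγ : γ ≠ 0)
    (hx : ψ.pullback E'.x = algebraMap k[X] E.FunctionField (C α * X + C β))
    (hy : ψ.pullback E'.y = algebraMap k E.FunctionField γ * E.y) {P : E.Point} {Q : E'.Point}
    (hQ : E'.IsAffinePoint Q (α * a + β) (γ * b)) : ψ.Sends P Q ↔ E.IsAffinePoint P a b := by
  have hmul {s c : k} (hs : s ≠ 0) (g : E.FunctionField) :
      algebraMap k E.FunctionField s * g ∈ P.ring.nonunits ↔ g ∈ P.ring.nonunits := by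
    rw [← Place.Vanishes, ← Place.Vanishes, ← P.valuation_lt_one_iff, ← P.valuation_lt_one_iff,
      map_mul, P.valuation_algebraMap hs, one_mul]
  have hcoe (g) : (ψ.pullback : E'.FunctionField →+* E.FunctionField) g = ψ.pullback g := rfl
  have hx' : ψ.pullback (E'.x - algebraMap k E'.FunctionField (α * a + β)) =
      algebraMap k E.FunctionField α * (E.x - algebraMap k E.FunctionField a) := by
    rw [map_sub, ψ.pullback.commutes, hx, map_add, map_mul, algebraMap_C, algebraMap_C,
      algebraMap_X, map_add, map_mul]
    ring
  have hy' : ψ.pullback (E'.y - algebraMap k E'.FunctionField (γ * b)) =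
      algebraMap k E.FunctionField γ * (E.y - algebraMap k E.FunctionField b) := by
    rw [map_sub, ψ.pullback.commutes, hy, map_mul]
    ring
  have hvx : E'.x - algebraMap k E'.FunctionField (α * a + β) ∈
      (P.ring.comap (ψ.pullback : E'.FunctionField →+* E.FunctionField)).nonunits ↔
      P.HasValue E.x a := by
    rw [mem_nonunits_comap_iff, hcoe, hx', hmul (c := α) hα]; rfl
  have hvy : E'.y - algebraMap k E'.FunctionField (γ * b) ∈
      (P.ring.comap (ψ.pullback : E'.FunctionField →+* E.FunctionField)).nonunits ↔
      P.HasValue E.y b := by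
    rw [mem_nonunits_comap_iff, hcoe, hy', hmul (c := α) hγ]; rfl
  constructor
  · intro h
    rw [Sends, Place.MapsTo] at h
    rw [← h] at hvx hvy
    exact ⟨hvx.1 hQ.1, hvy.1 hQ.2⟩
  · intro h
    refine (hQ.ring_eq (fun c => ?_) (hvx.2 h.1) (hvy.2 h.2)).symm
    rw [ValuationSubring.mem_comap, hcoe, ψ.pullback.commutes]
    exact P.algebraMap_mem c

/-- The curve obtained by moving the point `(a, b)` to `(0, 1)`. -/
def translate (E : Curve k n d) (a : k) {b : k} (hb : b ≠ 0) : Curve k n d where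
  two_le := E.two_le
  lt := E.lt
  coprime := E.coprime
  cast_ne_zero := E.cast_ne_zero
  poly := C (b⁻¹ ^ d) * E.poly.comp (X + C a)
  natDegree_poly := by
    rw [natDegree_C_mul (pow_ne_zero _ (inv_ne_zero hb)), natDegree_comp, natDegree_X_add_C,
      mul_one, E.natDegree_poly]
  separable := by
    refine Separable.unit_mul
      (isUnit_C.2 (isUnit_iff_ne_zero.2 (pow_ne_zero _ (inv_ne_zero hb)))) ?_
    have h := IsCoprime.map E.separable (compRingHom (X + C a))
    rw [coe_compRingHom_apply, coe_compRingHom_apply] at h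
    rw [Separable, derivative_comp]
    simpa using h

theorem exists_isNormalForm_iff (P : E.RationalPoint) :
    (∃ a b w, E.IsAffinePoint P.1 a b ∧ IsTangentForm n d E.poly a b w) ↔
      ∃ E' : Curve k n d, IsNormalForm n d E'.poly ∧ ∃ (ψ : Iso E E') (Q : E'.RationalPoint),
        ψ.PreservesInfinity ∧ E'.IsAffinePoint Q.1 0 1 ∧ ψ.Sends P.1 Q.1 := by
  constructor
  · rintro ⟨a, b, w, hP, hw⟩
    have hb := hw.b_ne_zero
    have hb' := inv_ne_zero hb
    have hbd : C (b ^ d) * C (b⁻¹ ^ d) = (1 : k[X]) := by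
      rw [← C_mul, ← mul_pow, mul_inv_cancel₀ hb, one_pow, C_1]
    have hw' : IsTangentForm n d (E.translate a hb).poly 0 1 _ :=
      isTangentForm_comp (α := 1) (β := a) (γ := b) one_ne_zero hb hw (by
        rw [translate, ← mul_assoc, hbd, one_mul, C_1, one_mul]) (by simp) (by simp)
    -- The isomorphism is `(x, y) ↦ (x - a, y/b)`, inverse to the substitution that defines
    -- `translate`.
    obtain ⟨ψ, hx, hy⟩ := exists_iso (E := E) (E' := E.translate a hb) (α := 1) (β := -a)
      (γ := b⁻¹) one_ne_zero hb' (by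
        rw [translate, mul_comp, C_comp, comp_assoc]; simp)
    obtain ⟨Q, hQ⟩ := (E.translate a hb).exists_isAffinePoint (a := 0) (b := 1) (by
      rw [translate]; simp [← hP.pow_eq, hb])
    refine ⟨E.translate a hb, (isNormalForm_iff _).2 ⟨_, hw'⟩, ψ, ⟨Q, hQ.isRational⟩,
      ψ.preservesInfinity one_ne_zero hx, hQ, ?_⟩
    refine (ψ.sends_iff_of_isAffinePoint one_ne_zero hb' hx hy (a := a) (b := b) ?_).2 hP
    rwa [one_mul, add_neg_cancel, inv_mul_cancel₀ hb]
  · rintro ⟨E', hE', ψ, Q, hψ, hQ, hPQ⟩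
    obtain ⟨w, hw⟩ := (isNormalForm_iff E').1 hE'
    obtain ⟨α, β, γ, hα, hγ, hx, hy, h⟩ := ψ.exists_eq hψ
    have ha : α * (-β / α) + β = 0 := by field_simp; ring
    have hb : γ * γ⁻¹ = 1 := mul_inv_cancel₀ hγ
    -- These are the coordinates of the preimage of `(0, 1)` under `(x, y) ↦ (αx + β, γy)`.
    refine ⟨-β / α, γ⁻¹, _, ?_, isTangentForm_comp hα hγ hw h ha hb⟩
    refine (ψ.sends_iff_of_isAffinePoint hα hγ hx hy ?_).1 hPQ
    rwa [ha, hb]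

end Curve
end Superelliptic

end

theorem mainTheorem6 {K₀ K : Type*} [Field K₀] [PerfectField K₀] [Field K] [IsAlgClosed K]
    [Algebra K₀ K] {n d : ℕ} (hnd : 0 ≤ (n : ℤ) - Superelliptic.m0 n d + Superelliptic.ell0 n d)
    (E : Superelliptic.Curve K₀ n d) (P : E.RationalPoint) :
    (E.HasOrder K P (Superelliptic.m0 n d) ↔
      ∃ E' : Superelliptic.Curve K₀ n d, Superelliptic.IsNormalForm n d E'.poly ∧
        ∃ (ψ : Superelliptic.Curve.Iso E E') (Q : E'.RationalPoint),
          ψ.PreservesInfinity ∧ E'.IsAffinePoint Q.1 0 1 ∧ ψ.Sends P.1 Q.1) ∧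
    ∀ E' : Superelliptic.Curve K₀ n d, Superelliptic.IsNormalForm n d E'.poly →
      ∃ Q : E'.RationalPoint, E'.IsAffinePoint Q.1 0 1 ∧
        E'.HasOrder K Q (Superelliptic.m0 n d) := by
  refine ⟨(Superelliptic.Curve.hasOrder_m0_iff P).trans
    (Superelliptic.Curve.exists_isNormalForm_iff P), fun E' hE' => ?_⟩
  obtain ⟨w, hw⟩ := (Superelliptic.Curve.isNormalForm_iff E').1 hE'
  obtain ⟨Q, hQ⟩ := E'.exists_isAffinePoint (a := 0) (b := 1) (by
    rw [hw.2.2, ← hw.2.1]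
    have := Superelliptic.lt_m0 E'
    simp [zero_pow (by omega : Superelliptic.m0 n d ≠ 0)])
  exact ⟨⟨Q, hQ.isRational⟩, hQ, (Superelliptic.Curve.hasOrder_m0_iff _).2 ⟨0, 1, w, hQ, hw⟩⟩
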